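/- **Conventions.** All posets are finite. For a poset $Q$, $\tilde H_i(Q)$ ($i\ge -1$) is the reduced simplicial homology with complex coefficients of the order complex of $Q$ (so $\tilde H_{-1}(\emptyset)=\mathbb C$). A poset is *ranked of length $n$* if all its maximal chains have length $n$ (that is, $n+1$ elements); the rank $r_Q(x)$ is the length of $\{y\in Q: y\le x\}$. If $Q$ has a minimum $\hat 0$, put $Q^-=Q\setminus\{\hat 0\}$; $Q^*$ denotes the dual poset. The *Rees product* of ranked posets is $Q*R=\{(q,r)\in Q\times R: r_Q(q)\ge r_R(r)\}$ with $(q_1,r_1)\le (q_2,r_2)$ iff $q_1\le q_2$, $r_1\le r_2$ and $r_Q(q_2)-r_Q(q_1)\ge r_R(r_2)-r_R(r_1)$. Let $C_n=\{0<1<\dots<n-1\}$ and let $T_{t,n}$ be the poset whose Hasse diagram is the complete $t$-ary tree of height $n$ with the root at the bottom. For a bounded ranked poset $P$ of length $n\ge 1$ with maximum $\hat 1$ and $0\le j\le n-1$, $I_j(P)$ is the open principal lower order ideal $\{z\in P^-*C_n: z<(\hat 1,j)\}$. If a group $G$ acts on a poset $Q$ by order-preserving bijections, then it acts linearly on $\tilde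 H_i(Q)$, and the *Lefschetz character* of $Q$ is the virtual representation $L(Q;G)=\bigoplus_{i\ge -1}(-1)^i\tilde H_i(Q)$ of $G$. An action on $P$ induces actions on $I_j(P)$ and on $(P^**T_{t,n})^-$ by acting on the first coordinate. $P$ is *Cohen–Macaulay* if for all $x<y$ in the poset obtained from $P$ by adding a new minimum and a new maximum, the homology $\tilde H_i((x,y))$ of the open interval vanishes for all $i$ smaller than the length of $(x,y)$. **Theorem (Equivariant Tree Lemma).** Let $n\ge 1$, let $G$ be a group and let $P$ be a bounded ranked poset of length $n$ on which $G$ acts by order-preserving bijections. Then for every integer $t\ge 1$ there is an isomorphism of virtual representations of $G$ $$\bigoplus_{j=1}^{n} t^j\, L(I_{j-1}(P);G)\;\cong_G\; -L\big((P^**T_{t,n})^-;G\big).$$ Consequently, if $P$ is Cohen–Macaulay, then for every integer $t\ge 1$ there is an isomorphism of representations of $G$ $$\bigoplus_{j=1}^{n} t^j\,\tilde H_{n-2}(I_{j-1}(P))\;\cong_G\;\tilde H_{n-1}\big((P^**T_{t,n})^-\big),$$ where $t^jV$ denotes the direct sum of $t^j$ copies of $V$. -/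

import Mathlib

namespace ReesTree

universe u v

/-! ### Representations up to isomorphism and virtual representations -/

/-- A finite-dimensional complex representation of the group `G`. -/
structure FinDimRep (G : Type v) [Group G] : Type (max v (u + 1)) where
  carrier : Type u
  [addCommGroup : AddCommGroup carrier]
  [module : Module ℂ carrier]
  [finite : Module.Finite ℂ carrier]
  rep : Representation ℂ G carrier

attribute [instance] FinDimRep.addCommGroup FinDimRep.module FinDimRep.finite

/-- Isomorphism of representations. -/
instance FinDimRep.setoid (G : Type v) [Group G] : Setoid (FinDimRep.{u, v} G) where
  r V W := Nonempty (V.rep.Equiv W.rep)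
  iseqv :=
    ⟨fun V => ⟨Representation.Equiv.refl V.rep⟩, fun ⟨e⟩ => ⟨e.symm⟩, fun ⟨e⟩ ⟨f⟩ => ⟨e.trans f⟩⟩

/-- Isomorphism classes of finite-dimensional complex representations of `G`. -/
def RepClass (G : Type v) [Group G] : Type (max v (u + 1)) :=
  Quotient (FinDimRep.setoid.{u, v} G)

/-- The isomorphism class of a representation. -/
def RepClass.mk {G : Type v} [Group G] {V : Type u} [AddCommGroup V] [Module ℂ V]
    [Module.Finite ℂ V] (ρ : Representation ℂ G V) : RepClass.{u, v} G :=
  Quotient.mk (FinDimRep.setoid.{u, v} G) ⟨V, ρ⟩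

/-- The direct sum. -/
noncomputable instance RepClass.add (G : Type v) [Group G] : Add (RepClass.{u, v} G) where
  add := Quotient.map₂ (fun V W => ⟨V.carrier × W.carrier, V.rep.prod W.rep⟩) (by
    rintro V V' ⟨e⟩ W W' ⟨f⟩
    refine ⟨Representation.Equiv.mk (e.toLinearEquiv.prodCongr f.toLinearEquiv) fun g => ?_⟩
    refine LinearMap.ext fun x => Prod.ext ?_ ?_
    · exact e.toIntertwiningMap.isIntertwining _ _ g x.1
    · exact f.toIntertwiningMap.isIntertwining _ _ g x.2)

/-- The zero representation. -/
instance RepClass.zero (G : Type v) [Group G] : Zero (RepClass.{u, v} G) where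
  zero := Quotient.mk _ ⟨PUnit, 1⟩

/-- Isomorphism classes form a commutative monoid under direct sum. -/
noncomputable instance RepClass.addCommMonoid (G : Type v) [Group G] :
    AddCommMonoid (RepClass.{u, v} G) where
  add_assoc := by
    rintro ⟨U⟩ ⟨V⟩ ⟨W⟩
    exact Quotient.sound
      ⟨Representation.Equiv.mk (LinearEquiv.prodAssoc ℂ U.carrier V.carrier W.carrier)
        fun g => rfl⟩
  zero_add := by
    rintro ⟨V⟩
    exact Quotient.sound
      ⟨Representation.Equiv.mk 
        (LinearEquiv.uniqueProd (R := ℂ) (M := V.carrier) (M₂ := PUnit.{u + 1})) fun g => rfl⟩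
  add_zero := by
    rintro ⟨V⟩
    exact Quotient.sound
      ⟨Representation.Equiv.mk 
        (LinearEquiv.prodUnique (R := ℂ) (M := V.carrier) (M₂ := PUnit.{u + 1})) fun g => rfl⟩
  add_comm := by
    rintro ⟨V⟩ ⟨W⟩
    exact Quotient.sound
      ⟨Representation.Equiv.mk (LinearEquiv.prodComm ℂ V.carrier W.carrier) fun g => rfl⟩
  nsmul := nsmulRec

/-- Virtual representations of `G`: formal differences of finite-dimensional representations.
Equality in this group is isomorphism of virtual representations. -/
abbrev VirtualRep (G : Type v) [Group G] : Type (max v (u + 1)) :=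
  Algebra.GrothendieckAddGroup (RepClass.{u, v} G)

/-- The virtual representation given by an actual representation. -/
noncomputable def VirtualRep.mk {G : Type v} [Group G] {V : Type u} [AddCommGroup V] [Module ℂ V]
    [Module.Finite ℂ V] (ρ : Representation ℂ G V) : VirtualRep.{u, v} G :=
  Algebra.GrothendieckAddGroup.of (RepClass.mk ρ)

/-! ### Reduced homology of the order complex -/

section Homology

variable (P : Type u) [PartialOrder P]

/-- The `(m - 1)`-chains of the order complex of `P`: formal complex linear
combinations of the chains `x₀ < ⋯ < x_{m-1}` of `m` elements of `P`, i.e. of the totally ordered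
subsets of size `m`, listed increasingly.  For `m = 0` there is exactly one such chain, the empty
one, so that the complex is augmented. -/
def OrderChains (m : ℕ) : Type u := (Fin m ↪o P) →₀ ℂ

noncomputable instance (m : ℕ) : AddCommGroup (OrderChains P m) :=
  inferInstanceAs (AddCommGroup ((Fin m ↪o P) →₀ ℂ))

noncomputable instance (m : ℕ) : Module ℂ (OrderChains P m) :=
  inferInstanceAs (Module ℂ ((Fin m ↪o P) →₀ ℂ))

instance finite_orderEmbedding [Finite P] (m : ℕ) : Finite (Fin m ↪o P) :=
  Finite.of_injective (fun c : Fin m ↪o P => (c : Fin m → P)) DFunLike.coe_injective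

instance [Finite P] (m : ℕ) : Module.Finite ℂ (OrderChains P m) :=
  inferInstanceAs (Module.Finite ℂ ((Fin m ↪o P) →₀ ℂ))

/-- The basis of the space of chains that consists of the simplices `x₀ < ⋯ < x_{m-1}`. -/
noncomputable def simplex (m : ℕ) : Module.Basis (Fin m ↪o P) ℂ (OrderChains P m) :=
  Module.Basis.ofRepr (LinearEquiv.refl ℂ ((Fin m ↪o P) →₀ ℂ))

/-- The simplicial boundary map: it sends `x₀ < ⋯ < x_m` to `∑ i, (-1) ^ i` times the chain
with `x_i` left out. -/
noncomputable def boundary (m : ℕ) : OrderChains P (m + 1) →ₗ[ℂ] OrderChains P m :=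
  (simplex P (m + 1)).constr ℂ fun c =>
    ∑ i : Fin (m + 1), (-1 : ℂ) ^ (i : ℕ) • simplex P m ((Fin.succAboveOrderEmb i).trans c)

theorem boundary_boundary (m : ℕ) (x : OrderChains P (m + 2)) :
    boundary P m (boundary P (m + 1) x) = 0 := by
  have h : boundary P m ∘ₗ boundary P (m + 1) = 0 := (simplex P (m + 2)).ext fun c => by
    simp only [LinearMap.comp_apply, boundary, Module.Basis.constr_basis, map_sum, map_smul,
      LinearMap.zero_apply, Finset.smul_sum, smul_smul, ← pow_add]
    rw [← Finset.sum_product']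
    refine Finset.sum_involution (fun p _ => (p.1.succAbove p.2, p.2.predAbove p.1)) ?_ ?_ ?_ ?_
    · rintro ⟨i, j⟩ -
      have e : (Fin.succAboveOrderEmb (j.predAbove i)).trans
          ((Fin.succAboveOrderEmb (i.succAbove j)).trans c) =
          (Fin.succAboveOrderEmb j).trans ((Fin.succAboveOrderEmb i).trans c) := by
        ext l
        exact congrArg c (Fin.succAbove_succAbove_succAbove_predAbove i j l)
      dsimp only
      rw [e, ← add_smul, Fin.neg_one_pow_succAbove_add_predAbove, add_neg_cancel, zero_smul]
    · rintro ⟨i, j⟩ - _ h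
      exact Fin.succAbove_ne i j (congrArg Prod.fst h)
    · simp
    · rintro ⟨i, j⟩ -
      exact Prod.ext (Fin.succAbove_succAbove_predAbove i j) (Fin.predAbove_predAbove_succAbove i j)
  exact LinearMap.congr_fun h x

/-- The `(m - 1)`-cycles. -/
noncomputable def cycles : (m : ℕ) → Submodule ℂ (OrderChains P m)
  | 0 => ⊤
  | m + 1 => LinearMap.ker (boundary P m)

/-- The `(m - 1)`-boundaries. -/
noncomputable def boundaries (m : ℕ) : Submodule ℂ (OrderChains P m) :=
  LinearMap.range (boundary P m)

theorem boundaries_le_cycles (m : ℕ) : boundaries P m ≤ cycles P m := by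
  cases m with
  | zero => exact le_top
  | succ m =>
    rintro _ ⟨x, rfl⟩
    exact boundary_boundary P m x

/-- `RedHomology P m` is the reduced homology `H̃_{m-1}(P)` of the order complex of `P` with
complex coefficients.  (The index is the number of vertices of the simplices in question, so that
all degrees from `-1` on are covered.) -/
abbrev RedHomology (m : ℕ) : Type u :=
  cycles P m ⧸ (boundaries P m).submoduleOf (cycles P m)

/-- `P` is Cohen-Macaulay (over `ℂ`): the homology of every open interval `(x, y)` of the poset
obtained from `P` by adding a new minimum and a new maximum is concentrated in its top dimension,
i.e. `H̃_i((x, y)) = 0` for `i` less than the length of `(x, y)`. -/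
def IsCohenMacaulay : Prop :=
  ∀ x y : WithBot (WithTop P), x < y → ∀ m : ℕ,
    (m : WithBot ℕ∞) ≤ Order.krullDim (Set.Ioo x y) → Subsingleton (RedHomology (Set.Ioo x y) m)

end Homology

section Action

variable {G : Type v} [Group G] {P : Type u} [PartialOrder P]

/-- The representation on chains induced by an action `φ` of `G` on `P` by order automorphisms:
`g` sends `x₀ < ⋯ < x_{m-1}` to `g x₀ < ⋯ < g x_{m-1}`. -/
noncomputable def chainRep (φ : G →* (P ≃o P)) (m : ℕ) : Representation ℂ G (OrderChains P m) where
  toFun g := (simplex P m).constr ℂ fun c => simplex P m (c.trans (φ g).toOrderEmbedding)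
  map_one' := (simplex P m).ext fun c => by
    rw [Module.Basis.constr_basis, map_one]; rfl
  map_mul' g h := (simplex P m).ext fun c => by
    rw [Module.Basis.constr_basis, Module.End.mul_apply, Module.Basis.constr_basis,
      Module.Basis.constr_basis, map_mul]; rfl

theorem chainRep_simplex (φ : G →* (P ≃o P)) (m : ℕ) (g : G) (c : Fin m ↪o P) :
    chainRep φ m g (simplex P m c) = simplex P m (c.trans (φ g).toOrderEmbedding) :=
  Module.Basis.constr_basis _ _ _ _

theorem boundary_chainRep (φ : G →* (P ≃o P)) (m : ℕ) (g : G) (x : OrderChains P (m + 1)) :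
    boundary P m (chainRep φ (m + 1) g x) = chainRep φ m g (boundary P m x) := by
  have h : boundary P m ∘ₗ chainRep φ (m + 1) g = chainRep φ m g ∘ₗ boundary P m :=
    (simplex P (m + 1)).ext fun c => by
      simp only [LinearMap.comp_apply, chainRep_simplex, boundary, Module.Basis.constr_basis,
        map_sum, map_smul]
      rfl
  exact LinearMap.congr_fun h x

theorem cycles_invariant (φ : G →* (P ≃o P)) (m : ℕ) (g : G) :
    cycles P m ≤ (cycles P m).comap (chainRep φ m g) := by
  cases m with
  | zero => exact le_top
  | succ m =>
    intro x hx
    have hx' : boundary P m x = 0 := hx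
    change boundary P m (chainRep φ (m + 1) g x) = 0
    rw [boundary_chainRep, hx', map_zero]

theorem boundaries_invariant (φ : G →* (P ≃o P)) (m : ℕ) (g : G) :
    boundaries P m ≤ (boundaries P m).comap (chainRep φ m g) := by
  rintro _ ⟨y, rfl⟩
  exact ⟨chainRep φ (m + 1) g y, boundary_chainRep φ m g y⟩

/-- The representation of `G` on `H̃_{m-1}(P)` induced by an action on `P`. -/
noncomputable def homologyRep (φ : G →* (P ≃o P)) (m : ℕ) :
    Representation ℂ G (RedHomology P m) :=
  ((chainRep φ m).subrepresentation (cycles P m) (cycles_invariant φ m)).quotient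
    ((boundaries P m).submoduleOf (cycles P m)) fun g x hx =>
      boundaries_invariant φ m g (show (x : OrderChains P m) ∈ boundaries P m from hx)

/-- The Lefschetz virtual character `L(P; G) = ⨁_j (-1)^j H̃_j(P)`, the sum over all `j ≥ -1`.
With `m = j + 1`; a chain in `P` has at most `|P|` elements, so the terms left out vanish. -/
noncomputable def lefschetz [Finite P] (φ : G →* (P ≃o P)) : VirtualRep.{u, v} G :=
  ∑ m ∈ Finset.range (Nat.card P + 1), (-1 : ℤ) ^ (m + 1) • VirtualRep.mk (homologyRep φ m)

/-- The action on an invariant subposet. -/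
def restrictAction (φ : G →* (P ≃o P)) (s : Set P) (hs : ∀ g, ∀ x ∈ s, φ g x ∈ s) :
    G →* (s ≃o s) where
  toFun g :=
    { toFun := fun x => ⟨φ g x, hs g x x.2⟩
      invFun := fun x => ⟨φ g⁻¹ x, hs g⁻¹ x x.2⟩
      left_inv := fun x => Subtype.ext (by
        change (φ g⁻¹ * φ g) (x : P) = x
        rw [← map_mul, inv_mul_cancel, map_one]; rfl)
      right_inv := fun x => Subtype.ext (by
        change (φ g * φ g⁻¹) (x : P) = x
        rw [← map_mul, mul_inv_cancel, map_one]; rfl)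
      map_rel_iff' := fun {x y} => (φ g).map_rel_iff (a := (x : P)) (b := (y : P)) }
  map_one' := by
    ext x
    change φ 1 (x : P) = x
    rw [map_one]; rfl
  map_mul' g h := by
    ext x
    change φ (g * h) (x : P) = φ g (φ h x)
    rw [map_mul]; rfl

/-- The same action, on the dual poset. -/
def dualAction (φ : G →* (P ≃o P)) : G →* (Pᵒᵈ ≃o Pᵒᵈ) where
  toFun g := (φ g).dual
  map_one' := by rw [map_one]; rfl
  map_mul' g h := by rw [map_mul]; rfl

end Action

/-! ### Ranked posets, truncation and Rees products -/

/-- `P` is ranked of length `n`: all its maximal chains have length `n`, that is, have `n + 1`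
elements. -/
def IsRankedOfLength (P : Type u) [PartialOrder P] (n : ℕ) : Prop :=
  ∀ s : Set P, IsMaxChain (· ≤ ·) s → s.encard = n + 1

/-- The rank of `x`: the length of the principal lower order ideal `{y | y ≤ x}`. -/
noncomputable def rank {P : Type u} [PartialOrder P] (x : P) : ℕ := (Order.height x).toNat

theorem rank_orderIso {P : Type u} [PartialOrder P] (e : P ≃o P) (x : P) :
    rank (e x) = rank x := by
  rw [rank, rank, Order.height_orderIso]

theorem rank_bot {P : Type u} [PartialOrder P] [OrderBot P] : rank (⊥ : P) = 0 := by
  rw [rank, Order.height_bot]; rfl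

/-- The truncated poset `P⁻ = P \ {0̂}`. -/
abbrev Trunc (P : Type u) [PartialOrder P] [OrderBot P] : Type u := ({⊥}ᶜ : Set P)

/-- The action on the truncated poset. -/
def truncAction {G : Type v} [Group G] {P : Type u} [PartialOrder P] [OrderBot P]
    (φ : G →* (P ≃o P)) : G →* (Trunc P ≃o Trunc P) :=
  restrictAction φ ({⊥}ᶜ : Set P) fun g x hx h => hx (by
    have h' : φ g x = ⊥ := h
    simpa using h')

/-- The Rees product `P * Q`. -/
@[ext]
structure Rees (P : Type u) (Q : Type v) [PartialOrder P] [PartialOrder Q] where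
  fst : P
  snd : Q
  rank_le : rank snd ≤ rank fst

section Rees

variable {P : Type u} {Q : Type v} [PartialOrder P] [PartialOrder Q]

/-- `(p₁, q₁) ≤ (p₂, q₂)` iff `p₁ ≤ p₂`, `q₁ ≤ q₂` and `r(p₂) - r(p₁) ≥ r(q₂) - r(q₁)`. -/
instance : PartialOrder (Rees P Q) where
  le a b := a.fst ≤ b.fst ∧ a.snd ≤ b.snd ∧
    (rank b.snd : ℤ) - rank a.snd ≤ (rank b.fst : ℤ) - rank a.fst
  le_refl a := ⟨le_rfl, le_rfl, by omega⟩
  le_trans a b c h h' := ⟨h.1.trans h'.1, h.2.1.trans h'.2.1, by have := h.2.2; have := h'.2.2; omega⟩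
  le_antisymm a b h h' := Rees.ext (h.1.antisymm h'.1) (h.2.1.antisymm h'.2.1)

instance [Finite P] [Finite Q] : Finite (Rees P Q) :=
  Finite.of_injective (fun a : Rees P Q => (a.fst, a.snd)) fun _ _ h =>
    Rees.ext (congrArg Prod.fst h) (congrArg Prod.snd h)

instance [OrderBot P] [OrderBot Q] : OrderBot (Rees P Q) where
  bot := ⟨⊥, ⊥, by rw [rank_bot, rank_bot]⟩
  bot_le a := ⟨bot_le, bot_le, by
    have := a.rank_le
    change (rank a.snd : ℤ) - rank (⊥ : Q) ≤ (rank a.fst : ℤ) - rank (⊥ : P)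
    rw [rank_bot, rank_bot]; omega⟩

/-- The action on a Rees product by means of an action on the first factor. -/
def reesAction {G : Type*} [Group G] (φ : G →* (P ≃o P)) (Q : Type v) [PartialOrder Q] :
    G →* (Rees P Q ≃o Rees P Q) where
  toFun g :=
    { toFun := fun a => ⟨φ g a.fst, a.snd, by rw [rank_orderIso]; exact a.rank_le⟩
      invFun := fun a => ⟨φ g⁻¹ a.fst, a.snd, by rw [rank_orderIso]; exact a.rank_le⟩
      left_inv := fun a => Rees.ext (by
        change (φ g⁻¹ * φ g) a.fst = a.fst
        rw [← map_mul, inv_mul_cancel, map_one]; rfl) rfl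
      right_inv := fun a => Rees.ext (by
        change (φ g * φ g⁻¹) a.fst = a.fst
        rw [← map_mul, mul_inv_cancel, map_one]; rfl) rfl
      map_rel_iff' := fun {a b} => by
        change (φ g a.fst ≤ φ g b.fst ∧ a.snd ≤ b.snd ∧
          (rank b.snd : ℤ) - rank a.snd ≤ (rank (φ g b.fst) : ℤ) - rank (φ g a.fst)) ↔
          (a.fst ≤ b.fst ∧ a.snd ≤ b.snd ∧
          (rank b.snd : ℤ) - rank a.snd ≤ (rank b.fst : ℤ) - rank a.fst)
        rw [rank_orderIso, rank_orderIso, OrderIso.le_iff_le] }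
  map_one' := by
    refine RelIso.ext fun a => Rees.ext ?_ rfl
    change φ 1 a.fst = a.fst
    rw [map_one]; rfl
  map_mul' g h := by
    refine RelIso.ext fun a => Rees.ext ?_ rfl
    change φ (g * h) a.fst = φ g (φ h a.fst)
    rw [map_mul]; rfl

end Rees

/-- The subposet `I_j(P)` of `P⁻ * C_n`, where `C_n = {0 < 1 < ⋯ < n - 1}`: the open principal
lower order ideal generated by `(1̂, j)`. -/
def openIdeal (P : Type u) [PartialOrder P] [BoundedOrder P] (n j : ℕ) :
    Set (Rees (Trunc P) (Fin n)) :=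
  {z | ∃ w : Rees (Trunc P) (Fin n), (w.fst : P) = ⊤ ∧ (w.snd : ℕ) = j ∧ z < w}

/-- The action on `I_j(P)`. -/
def openIdealAction {G : Type v} [Group G] {P : Type u} [PartialOrder P] [BoundedOrder P]
    (φ : G →* (P ≃o P)) (n j : ℕ) : G →* (openIdeal P n j ≃o openIdeal P n j) :=
  restrictAction (reesAction (truncAction φ) (Fin n)) (openIdeal P n j) (by
    rintro g z ⟨w, hw, hj, hz⟩
    refine ⟨reesAction (truncAction φ) (Fin n) g w, ?_, hj, (OrderIso.lt_iff_lt _).2 hz⟩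
    change φ g (w.fst : P) = ⊤
    rw [hw, OrderIso.map_top])

/-- The poset `T_{t,n}` whose Hasse diagram is the complete `t`-ary tree of height `n` with the
root at the bottom: the words of length at most `n` in `t` letters, ordered by the relation
"is an initial segment of". -/
def Tree (t n : ℕ) : Type := {w : List (Fin t) // w.length ≤ n}

instance (t n : ℕ) : PartialOrder (Tree t n) where
  le a b := a.1 <+: b.1
  le_refl a := List.prefix_refl a.1
  le_trans _ _ _ h h' := List.IsPrefix.trans h h'
  le_antisymm _ _ h h' := Subtype.ext (h.eq_of_length_le h'.length_le)

instance (t n : ℕ) : OrderBot (Tree t n) where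
  bot := ⟨[], Nat.zero_le n⟩
  bot_le _ := List.nil_prefix

instance (t n : ℕ) : Finite (Tree t n) :=
  (List.finite_length_le (Fin t) n).to_subtype

/-- The truncated Rees product `(P^* * T_{t,n})⁻` of the dual of `P` with the tree. -/
abbrev TreeProduct (P : Type u) [PartialOrder P] [BoundedOrder P] (t n : ℕ) : Type u :=
  Trunc (Rees Pᵒᵈ (Tree t n))

/-- The action on `(P^* * T_{t,n})⁻`. -/
def treeProductAction {G : Type v} [Group G] {P : Type u} [PartialOrder P] [BoundedOrder P]
    (φ : G →* (P ≃o P)) (t n : ℕ) : G →* (TreeProduct P t n ≃o TreeProduct P t n) :=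
  truncAction (reesAction (dualAction φ) (Tree t n))

end ReesTree

namespace ReesTree

universe u v

/-! ### Faces, cones, and chain maps along order embeddings. -/

section ChainOperations

variable {X : Type*} [PartialOrder X] {Y : Type*} [PartialOrder Y]

/-! Let `Y` be the dual of the truncated tree product. Its points are pairs of some `p ≠ ⊤` in `P`
and a word `w` with `|w| + rank p ≤ n`; going up in `Y` raises `p` and shortens `w`. Below each `(p,
w)` lies the apex `(⊥, w)`, so the apices form a copy of the vertices of the tree. For a nonempty
word `v`, the points lying above `(⊥, v)` whose word does not extend `v` form a copy of the ideal
`I_{|v|-1}(P)`: the pair `(p, i)` corresponds to `p` together with the prefix of `v` of length `|v|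
- 1 - i`. This copy also lies above `(⊥, v.dropLast)`, so each edge of the tree carries a suspension
of an ideal.

The reduced homology of `Y` is the direct sum of the homologies of these ideals, shifted by one.
`susp` takes the difference of the cones over the two ends of an edge, and `retr` removes the first
point of a chain. The composites `retr k ∘ susp i` are identities for `i = k` and zero otherwise. In
the other direction `∑ i, susp i ∘ retr i` is homotopic to the identity, through the homotopy that
adds the apex below the first point of a chain (`sum_susp_retr`). The reason is that the path in the
tree from the root to a word is the sum of its edges (`WordIndex.sum_prefix`). `ConeDecomposition`
isolates what this argument needs of `Y`.

All these maps are equivariant, because the group fixes every apex. There are `t ^ j` words of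
length `j`, and the shift by one produces the minus sign in the Lefschetz character. The isomorphism
is available in every degree, so the statement on top homology is one instance of it. -/

theorem simplex_ext {m : ℕ} {M : Type*} [AddCommGroup M] [Module ℂ M]
    {f g : OrderChains X m →ₗ[ℂ] M} (h : ∀ c, f (simplex X m c) = g (simplex X m c)) : f = g :=
  (simplex X m).ext h

/-- The `i`-th face of a simplex. -/
def face {m : ℕ} (i : Fin (m + 1)) (c : Fin (m + 1) ↪o X) : Fin m ↪o X :=
  (Fin.succAboveOrderEmb i).trans c

theorem face_apply {m : ℕ} (i : Fin (m + 1)) (c : Fin (m + 1) ↪o X) (k : Fin m) :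
    face i c k = c (i.succAbove k) := rfl

theorem boundary_simplex {m : ℕ} (c : Fin (m + 1) ↪o X) :
    boundary X m (simplex X (m + 1) c) =
      ∑ i : Fin (m + 1), (-1 : ℂ) ^ (i : ℕ) • simplex X m (face i c) :=
  Module.Basis.constr_basis _ _ _ _

/-- The chain `a < c₀ < ⋯`. -/
def consChain {m : ℕ} (a : X) (c : Fin m ↪o X) (h : ∀ k, a < c k) : Fin (m + 1) ↪o X :=
  OrderEmbedding.ofStrictMono (Fin.cons a c) (by
    intro i j hij
    induction j using Fin.cases with
    | zero => exact absurd hij (Fin.not_lt_zero i)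
    | succ j =>
      induction i using Fin.cases with
      | zero => simpa using h j
      | succ i => simpa using hij)

theorem consChain_zero {m : ℕ} (a : X) (c : Fin m ↪o X) (h : ∀ k, a < c k) :
    consChain a c h 0 = a := rfl

theorem face_zero_consChain {m : ℕ} (a : X) (c : Fin m ↪o X) (h : ∀ k, a < c k) :
    face 0 (consChain a c h) = c := by
  ext k; rfl

theorem zero_lt_face_zero {m : ℕ} (c : Fin (m + 1) ↪o X) (k : Fin m) : c 0 < face 0 c k :=
  c.strictMono (Fin.succ_pos k)

theorem consChain_face_zero {m : ℕ} (c : Fin (m + 1) ↪o X) :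
    consChain (c 0) (face 0 c) (zero_lt_face_zero c) = c := by
  ext k
  induction k using Fin.cases with
  | zero => rfl
  | succ k => rfl

theorem face_succ_consChain {m : ℕ} (a : X) (c : Fin (m + 1) ↪o X) (h : ∀ k, a < c k)
    (i : Fin (m + 1)) :
    face i.succ (consChain a c h) = consChain a (face i c) fun _ => h _ := by
  ext k
  induction k using Fin.cases with
  | zero => rw [face_apply, Fin.succ_succAbove_zero]; rfl
  | succ k => rw [face_apply, Fin.succ_succAbove_succ]; rfl

open Classical in
/-- The join with a point `a`, zero on simplices that are not above `a`. -/
noncomputable def cone (a : X) (m : ℕ) : OrderChains X m →ₗ[ℂ] OrderChains X (m + 1) :=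
  (simplex X m).constr ℂ fun c =>
    if h : ∀ k, a < c k then simplex X (m + 1) (consChain a c h) else 0

theorem cone_simplex {a : X} {m : ℕ} {c : Fin m ↪o X} (h : ∀ k, a < c k) :
    cone a m (simplex X m c) = simplex X (m + 1) (consChain a c h) := by
  rw [cone, Module.Basis.constr_basis, dif_pos h]

theorem cone_simplex_eq_zero {a : X} {m : ℕ} {c : Fin m ↪o X} (k : Fin m) (h : ¬ a < c k) :
    cone a m (simplex X m c) = 0 := by
  rw [cone, Module.Basis.constr_basis, dif_neg fun h' => h (h' k)]

theorem boundary_cone_simplex_zero (a : X) (c : Fin 0 ↪o X) :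
    boundary X 0 (cone a 0 (simplex X 0 c)) = simplex X 0 c := by
  rw [cone_simplex fun k => k.elim0, boundary_simplex]
  simp [face_zero_consChain]

/-- Removing the apex gives back `c`; every other face is the cone over a face of `c`, with its
index raised by one and hence its sign reversed. -/
theorem boundary_cone_simplex_succ {a : X} {m : ℕ} {c : Fin (m + 1) ↪o X} (h : ∀ k, a < c k) :
    boundary X (m + 1) (cone a (m + 1) (simplex X (m + 1) c)) =
      simplex X (m + 1) c - cone a m (boundary X m (simplex X (m + 1) c)) := by
  rw [cone_simplex h, boundary_simplex, Fin.sum_univ_succ, face_zero_consChain, boundary_simplex,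
    map_sum, sub_eq_add_neg, ← Finset.sum_neg_distrib]
  simp only [Fin.val_zero, pow_zero, one_smul, face_succ_consChain, map_smul]
  congr 1
  refine Finset.sum_congr rfl fun i _ => ?_
  rw [cone_simplex (c := face i c) fun k => h _, Fin.val_succ, pow_succ, mul_neg_one, neg_smul]

/-- The empty chain is the boundary of any vertex. -/
theorem subsingleton_redHomology_zero [Nonempty X] : Subsingleton (RedHomology X 0) := by
  rw [Submodule.Quotient.subsingleton_iff, eq_top_iff]
  rintro x -
  change (x : OrderChains X 0) ∈ boundaries X 0
  have a : X := Classical.arbitrary X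
  refine ⟨cone a 0 x, ?_⟩
  exact LinearMap.congr_fun (simplex_ext (f := boundary X 0 ∘ₗ cone a 0) (g := LinearMap.id)
    fun c => boundary_cone_simplex_zero _ c) _

/-- The map of chains induced by an order embedding. -/
noncomputable def push (f : X ↪o Y) (m : ℕ) : OrderChains X m →ₗ[ℂ] OrderChains Y m :=
  (simplex X m).constr ℂ fun c => simplex Y m (c.trans f)

theorem push_simplex (f : X ↪o Y) (m : ℕ) (c : Fin m ↪o X) :
    push f m (simplex X m c) = simplex Y m (c.trans f) :=
  Module.Basis.constr_basis _ _ _ _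

theorem boundary_push (f : X ↪o Y) (m : ℕ) (x : OrderChains X (m + 1)) :
    boundary Y m (push f (m + 1) x) = push f m (boundary X m x) := by
  refine LinearMap.congr_fun (simplex_ext (f := boundary Y m ∘ₗ push f (m + 1))
    (g := push f m ∘ₗ boundary X m) fun c => ?_) x
  simp only [LinearMap.comp_apply, push_simplex, boundary_simplex, map_sum, map_smul]
  rfl

theorem boundary_cone_push {f : X ↪o Y} {a : Y} (h : ∀ z, a < f z) (m : ℕ)
    (x : OrderChains X (m + 1)) :
    boundary Y (m + 1) (cone a (m + 1) (push f (m + 1) x)) =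
      push f (m + 1) x - cone a m (push f m (boundary X m x)) := by
  refine LinearMap.congr_fun (simplex_ext
    (f := boundary Y (m + 1) ∘ₗ cone a (m + 1) ∘ₗ push f (m + 1))
    (g := push f (m + 1) - cone a m ∘ₗ push f m ∘ₗ boundary X m) fun c => ?_) x
  simp only [LinearMap.comp_apply, LinearMap.sub_apply, ← boundary_push, push_simplex]
  exact boundary_cone_simplex_succ fun k => h _

open Classical in
/-- The left inverse of `push f` that vanishes on the simplices not in the range of `f`. -/
noncomputable def pull (f : X ↪o Y) (m : ℕ) : OrderChains Y m →ₗ[ℂ] OrderChains X m :=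
  (simplex Y m).constr ℂ fun c =>
    if h : ∃ d : Fin m ↪o X, d.trans f = c then simplex X m h.choose else 0

theorem pull_simplex_trans (f : X ↪o Y) (m : ℕ) (c : Fin m ↪o X) :
    pull f m (simplex Y m (c.trans f)) = simplex X m c := by
  have h : ∃ d : Fin m ↪o X, d.trans f = c.trans f := ⟨c, rfl⟩
  rw [pull, Module.Basis.constr_basis, dif_pos h]
  congr 1
  ext k
  exact f.injective (DFunLike.congr_fun h.choose_spec k)

theorem push_pull_simplex (f : X ↪o Y) (m : ℕ) (c : Fin m ↪o Y) (h : ∀ k, c k ∈ Set.range f) :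
    push f m (pull f m (simplex Y m c)) = simplex Y m c := by
  choose d hd using h
  have hd' : StrictMono d := fun i j hij => by
    rw [← f.lt_iff_lt, hd, hd]; exact c.strictMono hij
  have e : (OrderEmbedding.ofStrictMono d hd').trans f = c := by
    ext k; exact hd k
  rw [← e, pull_simplex_trans, push_simplex]

theorem pull_simplex_eq_zero (f : X ↪o Y) (m : ℕ) (c : Fin m ↪o Y) (k : Fin m)
    (h : c k ∉ Set.range f) : pull f m (simplex Y m c) = 0 := by
  rw [pull, Module.Basis.constr_basis, dif_neg]
  rintro ⟨d, rfl⟩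
  exact h ⟨d k, rfl⟩

end ChainOperations

/-! ### Posets decomposed by cones -/

/-- A combinatorial decomposition of a poset `Y`, which makes its order complex look like a wedge
of suspensions of the subposets `f i : J i ↪o Y`, with suspension points `a i` and `b i`. Every
element `y` of `Y` has a point `t y` below it, and `t_sub_o` expresses the path from `o` to `t y`
as the sum of the edges from `b i` to `a i`, for the `i` with `y ∈ U i`. -/
structure ConeDecomposition (Y : Type u) [PartialOrder Y] {ι : Type} [Fintype ι]
    (J : ι → Type u) [∀ i, PartialOrder (J i)] where
  t : Y → Y
  o : Y
  a : ι → Y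
  b : ι → Y
  U : ι → Set Y
  f : ∀ i, J i ↪o Y
  t_le : ∀ y, t y ≤ y
  t_ne : ∀ x y, x < y → t y ≠ y
  lower : ∀ i x y, x < y → y ∈ U i → x ∈ U i
  a_lt : ∀ i z, a i < f i z
  b_lt : ∀ i z, b i < f i z
  -- A chain that starts in `U i` and leaves it at its second point thus has its whole tail in the
  -- copy of `J i`; if the second point is still in `U i`, it is not in that copy.
  range_f : ∀ i x y, x ∈ U i → x < y → (y ∈ Set.range (f i) ↔ y ∉ U i)
  -- The edge from `b i` to `a i` enters `U k` only for `k = i`, which makes `retr k` dual to `susp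
  -- i`.
  a_mem : ∀ i k, a i ∈ U k ↔ b i ∈ U k ∨ i = k
  b_notMem : ∀ i, b i ∉ U i
  t_sub_o : ∀ x, (∑ i, (U i).indicator (1 : Y → ℂ) x •
    (Finsupp.single (a i) 1 - Finsupp.single (b i) 1) : Y →₀ ℂ) =
      Finsupp.single (t x) 1 - Finsupp.single o 1

namespace ConeDecomposition

variable {Y : Type u} [PartialOrder Y] {ι : Type} [Fintype ι] {J : ι → Type u}
  [∀ i, PartialOrder (J i)] (D : ConeDecomposition Y J)

/-- `t_sub_o` lives in the free vector space on `Y`, so it passes to any function on `Y`. The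
function needed later is `y ↦ cone y` on a fixed simplex, including the value zero when `y` is not
below it. -/
theorem sum_indicator_smul {M : Type*} [AddCommGroup M] [Module ℂ M] (F : Y → M) (x : Y) :
    ∑ i, (D.U i).indicator (1 : Y → ℂ) x • (F (D.a i) - F (D.b i)) = F (D.t x) - F D.o := by
  have h := congrArg (Finsupp.linearCombination ℂ F) (D.t_sub_o x)
  simpa [map_sum] using h

/-- The difference of the cones with apices `a i` and `b i`. -/
noncomputable def susp (i : ι) (m : ℕ) : OrderChains (J i) m →ₗ[ℂ] OrderChains Y (m + 1) :=
  (cone (D.a i) m - cone (D.b i) m) ∘ₗ push (D.f i) m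

theorem susp_apply (i : ι) (m : ℕ) (x : OrderChains (J i) m) :
    D.susp i m x = cone (D.a i) m (push (D.f i) m x) - cone (D.b i) m (push (D.f i) m x) := rfl

theorem boundary_susp_zero (i : ι) (x : OrderChains (J i) 0) :
    boundary Y 0 (D.susp i 0 x) = 0 := by
  refine LinearMap.congr_fun (simplex_ext (f := boundary Y 0 ∘ₗ D.susp i 0) (g := 0)
    fun c => ?_) x
  rw [LinearMap.comp_apply, susp_apply, map_sub, push_simplex, boundary_cone_simplex_zero,
    boundary_cone_simplex_zero, sub_self, LinearMap.zero_apply]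

/-- The two cones contribute the same base, which cancels in the difference. -/
theorem boundary_susp (i : ι) (m : ℕ) (x : OrderChains (J i) (m + 1)) :
    boundary Y (m + 1) (D.susp i (m + 1) x) = -D.susp i m (boundary (J i) m x) := by
  rw [susp_apply, susp_apply, map_sub, boundary_cone_push (D.a_lt i),
    boundary_cone_push (D.b_lt i)]
  abel

/-- The retraction onto the `i`-th summand: it removes the first element of a chain. -/
noncomputable def retr (i : ι) (m : ℕ) : OrderChains Y (m + 1) →ₗ[ℂ] OrderChains (J i) m :=
  (simplex Y (m + 1)).constr ℂ fun c =>
    (D.U i).indicator (1 : Y → ℂ) (c 0) • pull (D.f i) m (simplex Y m (face 0 c))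

theorem retr_simplex (i : ι) (m : ℕ) (c : Fin (m + 1) ↪o Y) :
    D.retr i m (simplex Y (m + 1) c) =
      (D.U i).indicator (1 : Y → ℂ) (c 0) • pull (D.f i) m (simplex Y m (face 0 c)) :=
  Module.Basis.constr_basis _ _ _ _

theorem retr_susp_simplex (i k : ι) (m : ℕ) (c : Fin m ↪o J i) :
    D.retr k m (D.susp i m (simplex (J i) m c)) =
      ((D.U k).indicator (1 : Y → ℂ) (D.a i) - (D.U k).indicator (1 : Y → ℂ) (D.b i)) •
        pull (D.f k) m (simplex Y m (c.trans (D.f i))) := by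
  have ha : ∀ l, D.a i < c.trans (D.f i) l := fun _ => D.a_lt i _
  have hb : ∀ l, D.b i < c.trans (D.f i) l := fun _ => D.b_lt i _
  rw [susp_apply, push_simplex, cone_simplex ha, cone_simplex hb, map_sub, retr_simplex,
    retr_simplex, face_zero_consChain, face_zero_consChain, consChain_zero, consChain_zero, sub_smul]

theorem retr_susp_self (i : ι) (m : ℕ) (x : OrderChains (J i) m) :
    D.retr i m (D.susp i m x) = x := by
  refine LinearMap.congr_fun (simplex_ext (f := D.retr i m ∘ₗ D.susp i m) (g := LinearMap.id)
    fun c => ?_) x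
  have ha : D.a i ∈ D.U i := (D.a_mem i i).2 (Or.inr rfl)
  rw [LinearMap.comp_apply, retr_susp_simplex, pull_simplex_trans, LinearMap.id_apply,
    Set.indicator_of_mem ha, Set.indicator_of_notMem (D.b_notMem i), Pi.one_apply, sub_zero,
    one_smul]

theorem retr_susp_of_ne {i k : ι} (h : i ≠ k) (m : ℕ) (x : OrderChains (J i) m) :
    D.retr k m (D.susp i m x) = 0 := by
  refine LinearMap.congr_fun (simplex_ext (f := D.retr k m ∘ₗ D.susp i m) (g := 0)
    fun c => ?_) x
  have hab : D.a i ∈ D.U k ↔ D.b i ∈ D.U k := by rw [D.a_mem, or_iff_left h]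
  rw [LinearMap.comp_apply, retr_susp_simplex, LinearMap.zero_apply]
  by_cases hb : D.b i ∈ D.U k
  · rw [Set.indicator_of_mem hb, Set.indicator_of_mem (hab.2 hb), Pi.one_apply, Pi.one_apply,
      sub_self, zero_smul]
  · rw [Set.indicator_of_notMem hb, Set.indicator_of_notMem fun h => hb (hab.1 h), sub_self,
      zero_smul]

/-- The chain homotopy: it adds the point `t c₀` to the chain `c`. -/
noncomputable def htpy : (m : ℕ) → OrderChains Y m →ₗ[ℂ] OrderChains Y (m + 1)
  -- The empty chain has no first point; the base point `o` replaces `t c₀`.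
  | 0 => cone D.o 0
  | m + 1 => (simplex Y (m + 1)).constr ℂ fun c =>
      cone (D.t (c 0)) (m + 1) (simplex Y (m + 1) c)

theorem htpy_simplex (m : ℕ) (c : Fin (m + 1) ↪o Y) :
    D.htpy (m + 1) (simplex Y (m + 1) c) = cone (D.t (c 0)) (m + 1) (simplex Y (m + 1) c) :=
  Module.Basis.constr_basis _ _ _ _

/-- Every face except the zeroth keeps the first point `c 0`, so the homotopy adds the same point `t
(c 0)` to it. -/
theorem htpy_boundary_simplex (m : ℕ) (c : Fin (m + 1) ↪o Y) :
    D.htpy m (boundary Y m (simplex Y (m + 1) c)) = D.htpy m (simplex Y m (face 0 c)) +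
      cone (D.t (c 0)) m (boundary Y m (simplex Y (m + 1) c) - simplex Y m (face 0 c)) := by
  rw [boundary_simplex, Fin.sum_univ_succ, Fin.val_zero, pow_zero, one_smul, map_add,
    add_sub_cancel_left]
  congr 1
  rw [map_sum, map_sum]
  refine Finset.sum_congr rfl fun i _ => ?_
  cases m with
  | zero => exact i.elim0
  | succ m =>
    rw [map_smul, map_smul, htpy_simplex, face_apply, Fin.succ_succAbove_zero]

theorem boundary_htpy_add (m : ℕ) (c : Fin (m + 1) ↪o Y) :
    boundary Y (m + 1) (D.htpy (m + 1) (simplex Y (m + 1) c)) +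
        D.htpy m (boundary Y m (simplex Y (m + 1) c)) =
      simplex Y (m + 1) c - (cone (D.t (c 0)) m (simplex Y m (face 0 c)) -
        D.htpy m (simplex Y m (face 0 c))) := by
  rw [htpy_boundary_simplex, htpy_simplex]
  -- If `t (c 0) = c 0`, the homotopy kills `c` and the faces that keep `c 0`, while `c` is itself
  -- the cone from `t (c 0)` over its zeroth face, so the right side reduces to the last term.
  rcases (D.t_le (c 0)).lt_or_eq with h | h
  · rw [boundary_cone_simplex_succ fun k => h.trans_le (c.monotone (Fin.zero_le k)), map_sub]
    abel
  · have e : cone (c 0) m (boundary Y m (simplex Y (m + 1) c) - simplex Y m (face 0 c)) = 0 := by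
      rw [boundary_simplex, Fin.sum_univ_succ, Fin.val_zero, pow_zero, one_smul,
        add_sub_cancel_left, map_sum]
      refine Finset.sum_eq_zero fun i _ => ?_
      cases m with
      | zero => exact i.elim0
      | succ m =>
        rw [map_smul, cone_simplex_eq_zero 0, smul_zero]
        rw [face_apply, Fin.succ_succAbove_zero]
        exact lt_irrefl _
    rw [h, e, cone_simplex_eq_zero 0 (lt_irrefl _), cone_simplex (zero_lt_face_zero c),
      consChain_face_zero, map_zero]
    abel

theorem susp_retr_simplex (i : ι) (m : ℕ) (c : Fin (m + 1) ↪o Y) :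
    D.susp i m (D.retr i m (simplex Y (m + 1) c)) =
      (D.U i).indicator (1 : Y → ℂ) (c 0) •
        (cone (D.a i) m - cone (D.b i) m)
          (push (D.f i) m (pull (D.f i) m (simplex Y m (face 0 c)))) := by
  rw [retr_simplex, map_smul]; rfl

/-- For nonempty tails the right side is the difference of the cones from `t (c 0)` and `t (c 1)`
over the tail. Comparing both with `o` writes it as a sum of edges weighted by the difference of the
indicators of `U i` at `c 0` and `c 1`. A weight survives exactly when the chain leaves `U i` after
its first point, which is when `retr i` does not vanish. -/
theorem sum_susp_retr_simplex (m : ℕ) (c : Fin (m + 1) ↪o Y) :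
    ∑ i, D.susp i m (D.retr i m (simplex Y (m + 1) c)) =
      cone (D.t (c 0)) m (simplex Y m (face 0 c)) - D.htpy m (simplex Y m (face 0 c)) := by
  simp only [susp_retr_simplex]
  cases m with
  | zero =>
    rw [htpy, ← D.sum_indicator_smul fun y => cone y 0 (simplex Y 0 (face 0 c))]
    refine Finset.sum_congr rfl fun i _ => ?_
    rw [push_pull_simplex _ _ _ fun k => k.elim0, LinearMap.sub_apply]
  | succ m =>
    have h01 : c 0 < c 1 := c.strictMono Fin.zero_lt_one
    have hc : ∀ k, c 0 < face 0 c k := zero_lt_face_zero c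
    have e0 : face 0 c 0 = c 1 := rfl
    rw [htpy_simplex, e0, ← sub_sub_sub_cancel_right _ _
      (cone D.o (m + 1) (simplex Y (m + 1) (face 0 c))),
      ← D.sum_indicator_smul fun y => cone y (m + 1) (simplex Y (m + 1) (face 0 c)),
      ← D.sum_indicator_smul fun y => cone y (m + 1) (simplex Y (m + 1) (face 0 c)),
      ← Finset.sum_sub_distrib]
    refine Finset.sum_congr rfl fun i _ => ?_
    rw [← sub_smul]
    by_cases hx : c 0 ∈ D.U i
    · by_cases hy : c 1 ∈ D.U i
      · rw [pull_simplex_eq_zero (D.f i) (m + 1) (face 0 c) 0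
          (fun h => (D.range_f i _ _ hx h01).1 h hy), Set.indicator_of_mem hx,
          Set.indicator_of_mem hy]
        simp
      · rw [push_pull_simplex, Set.indicator_of_mem hx, Set.indicator_of_notMem hy, sub_zero,
          LinearMap.sub_apply]
        -- `U i` is closed downwards, so once `c 1` is outside it, so is the rest of the tail.
        intro k
        rw [D.range_f i _ _ hx (hc k)]
        intro hk
        rcases (Fin.zero_le k).eq_or_lt with rfl | h0
        · exact hy hk
        · exact hy (D.lower i _ _ ((face 0 c).strictMono h0) hk)
    · rw [Set.indicator_of_notMem hx, Set.indicator_of_notMem fun h => hx (D.lower i _ _ h01 h),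
        sub_zero, zero_smul, zero_smul]

theorem sum_susp_retr (m : ℕ) (x : OrderChains Y (m + 1)) :
    ∑ i, D.susp i m (D.retr i m x) =
      x - boundary Y (m + 1) (D.htpy (m + 1) x) - D.htpy m (boundary Y m x) := by
  have h := LinearMap.congr_fun (simplex_ext (f := ∑ i, D.susp i m ∘ₗ D.retr i m)
    (g := LinearMap.id - boundary Y (m + 1) ∘ₗ D.htpy (m + 1) - D.htpy m ∘ₗ boundary Y m)
    fun c => ?_) x
  · simpa using h
  · have h := D.boundary_htpy_add m c
    rw [← sum_susp_retr_simplex] at h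
    simp only [LinearMap.sum_apply, LinearMap.comp_apply, LinearMap.sub_apply, LinearMap.id_apply]
    rw [sub_sub, h, sub_sub_cancel]

theorem retr_sum_susp [DecidableEq ι] (k : ι) (m : ℕ) (z : ∀ i, OrderChains (J i) m) :
    D.retr k m (∑ i, D.susp i m (z i)) = z k := by
  rw [map_sum, Finset.sum_eq_single k (fun i _ hi => D.retr_susp_of_ne hi m _)
    (fun h => absurd (Finset.mem_univ k) h), retr_susp_self]

/-- By the homotopy formula `∑ i, susp i ∘ retr i` commutes with the boundary; applying `retr k`
isolates one summand. -/
theorem retr_boundary (k : ι) (m : ℕ) (x : OrderChains Y (m + 2)) :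
    D.retr k m (boundary Y (m + 1) x) = -boundary (J k) m (D.retr k (m + 1) x) := by
  classical
  have h : ∑ i, D.susp i m (D.retr i m (boundary Y (m + 1) x)) =
      boundary Y (m + 1) (∑ i, D.susp i (m + 1) (D.retr i (m + 1) x)) := by
    rw [sum_susp_retr, sum_susp_retr, map_sub, map_sub, boundary_boundary, boundary_boundary,
      map_zero, sub_zero, sub_zero]
  have h' := congrArg (D.retr k m) h
  rw [retr_sum_susp, map_sum] at h'
  simp only [boundary_susp, ← map_neg] at h'
  rw [retr_sum_susp] at h'
  simpa using h'

theorem retr_mem_cycles (i : ι) (m : ℕ) (x : OrderChains Y (m + 1)) (hx : x ∈ cycles Y (m + 1)) :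
    D.retr i m x ∈ cycles (J i) m := by
  cases m with
  | zero => exact Submodule.mem_top
  | succ m =>
    have hx' : boundary Y (m + 1) x = 0 := hx
    have h := D.retr_boundary i m x
    rw [hx', map_zero, eq_comm, neg_eq_zero] at h
    exact h

theorem susp_mem_cycles (i : ι) (m : ℕ) (x : OrderChains (J i) m) (hx : x ∈ cycles (J i) m) :
    D.susp i m x ∈ cycles Y (m + 1) := by
  change boundary Y m _ = 0
  cases m with
  | zero => exact D.boundary_susp_zero i x
  | succ m =>
    have hx' : boundary (J i) m x = 0 := hx
    rw [boundary_susp, hx', map_zero, neg_zero]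

theorem susp_mem_boundaries (i : ι) (m : ℕ) (x : OrderChains (J i) m)
    (hx : x ∈ boundaries (J i) m) : D.susp i m x ∈ boundaries Y (m + 1) := by
  obtain ⟨y, rfl⟩ := hx
  exact ⟨-D.susp i (m + 1) y, by rw [map_neg, boundary_susp, neg_neg]⟩

/-- The map of homology induced by `susp`. -/
noncomputable def homologySusp (i : ι) (m : ℕ) :
    RedHomology (J i) m →ₗ[ℂ] RedHomology Y (m + 1) :=
  Submodule.mapQ _ _ ((D.susp i m).restrict (D.susp_mem_cycles i m)) fun x hx =>
    D.susp_mem_boundaries i m x hx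

open DirectSum

/-- The map from the direct sum of the homologies of the `J i` to the homology of `Y`. -/
noncomputable def sumSusp [DecidableEq ι] (m : ℕ) :
    (⨁ i, RedHomology (J i) m) →ₗ[ℂ] RedHomology Y (m + 1) :=
  DirectSum.toModule ℂ ι _ fun i => D.homologySusp i m

theorem sumSusp_apply [DecidableEq ι] (m : ℕ) (x : ⨁ i, RedHomology (J i) m) :
    D.sumSusp m x = ∑ i, D.homologySusp i m (x i) := by
  conv_lhs => rw [← DirectSum.sum_univ_of x]
  rw [map_sum]
  exact Finset.sum_congr rfl fun i _ =>
    DirectSum.toModule_lof ℂ i (φ := fun i => D.homologySusp i m) (x i)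

theorem sum_homologySusp_mk (m : ℕ) (z : ∀ i, cycles (J i) m) :
    ∑ i, D.homologySusp i m (Submodule.Quotient.mk (z i)) =
      Submodule.Quotient.mk (p := (boundaries Y (m + 1)).submoduleOf (cycles Y (m + 1)))
        (∑ i, ⟨D.susp i m (z i), D.susp_mem_cycles i m _ (z i).2⟩) := by
  rw [← Submodule.mkQ_apply, map_sum]
  rfl

/-- If `∑ susp i (z i)` is the boundary of `y`, applying `retr k` shows that `z k` is the boundary
of `-retr k y`. -/
theorem sumSusp_injective [DecidableEq ι] (m : ℕ) : Function.Injective (D.sumSusp m) := by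
  rw [injective_iff_map_eq_zero]
  intro x hx
  choose z hz using fun i => Submodule.Quotient.mk_surjective _ (x i)
  simp only [sumSusp_apply, ← hz, sum_homologySusp_mk] at hx
  rw [Submodule.Quotient.mk_eq_zero] at hx
  obtain ⟨y, hy⟩ : _ ∈ boundaries Y (m + 1) := hx
  refine DFinsupp.ext fun k => ?_
  rw [← hz k]
  refine (Submodule.Quotient.mk_eq_zero _).2
    (show (z k : OrderChains (J k) m) ∈ boundaries (J k) m from ?_)
  refine ⟨-D.retr k (m + 1) y, ?_⟩
  rw [map_neg, ← retr_boundary, hy]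
  simp only [Submodule.subtype_apply, AddSubmonoidClass.coe_finsetSum]
  exact D.retr_sum_susp k m fun i => z i

/-- On a cycle the homotopy formula loses its last term, so `x` is homologous to the sum of the
suspensions of its retracts. -/
theorem sumSusp_surjective [DecidableEq ι] (m : ℕ) : Function.Surjective (D.sumSusp m) := by
  intro y
  obtain ⟨x, rfl⟩ := Submodule.Quotient.mk_surjective _ y
  refine ⟨∑ i, DirectSum.of _ i
    (Submodule.Quotient.mk ⟨D.retr i m x, D.retr_mem_cycles i m x x.2⟩), ?_⟩
  rw [map_sum]
  have h := D.sum_homologySusp_mk m fun i => ⟨D.retr i m x, D.retr_mem_cycles i m x x.2⟩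
  refine (Finset.sum_congr rfl fun i _ => DirectSum.toModule_lof ℂ i _).trans (h.trans ?_)
  rw [eq_comm, Submodule.Quotient.eq]
  change _ ∈ boundaries Y (m + 1)
  refine ⟨D.htpy (m + 1) x, ?_⟩
  have hx : boundary Y m (x : OrderChains Y (m + 1)) = 0 := x.2
  simp only [Submodule.subtype_apply, AddSubgroupClass.coe_sub, AddSubmonoidClass.coe_finsetSum]
  rw [sum_susp_retr, hx, map_zero, sub_zero, sub_sub_cancel]

theorem susp_chainRep {G : Type v} [Group G] (φ : G →* (Y ≃o Y)) (ψ : ∀ i, G →* (J i ≃o J i))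
    (ha : ∀ g i, φ g (D.a i) = D.a i) (hb : ∀ g i, φ g (D.b i) = D.b i)
    (hf : ∀ g i z, D.f i (ψ i g z) = φ g (D.f i z)) (i : ι) (m : ℕ) (g : G)
    (x : OrderChains (J i) m) :
    D.susp i m (chainRep (ψ i) m g x) = chainRep φ (m + 1) g (D.susp i m x) := by
  refine LinearMap.congr_fun (simplex_ext (f := D.susp i m ∘ₗ chainRep (ψ i) m g)
    (g := chainRep φ (m + 1) g ∘ₗ D.susp i m) fun c => ?_) x
  have key : ∀ (p : Y) (hp : ∀ z, p < D.f i z), φ g p = p →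
      cone p m (simplex Y m ((c.trans (ψ i g).toOrderEmbedding).trans (D.f i))) =
        chainRep φ (m + 1) g (cone p m (simplex Y m (c.trans (D.f i)))) := by
    intro p hp e
    rw [cone_simplex (c := c.trans (D.f i)) fun _ => hp _,
      cone_simplex (c := (c.trans (ψ i g).toOrderEmbedding).trans (D.f i)) fun _ => hp _,
      chainRep_simplex]
    congr 1
    ext k
    induction k using Fin.cases with
    | zero => exact e.symm
    | succ k => exact hf g i (c k)
  rw [LinearMap.comp_apply, LinearMap.comp_apply, chainRep_simplex, susp_apply, susp_apply,
    push_simplex, push_simplex, map_sub, key _ (D.a_lt i) (ha g i), key _ (D.b_lt i) (hb g i)]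

/-- The homology of a poset with a cone decomposition, as a representation. -/
noncomputable def homologyEquiv [DecidableEq ι] {G : Type v} [Group G] (φ : G →* (Y ≃o Y))
    (ψ : ∀ i, G →* (J i ≃o J i))
    (ha : ∀ g i, φ g (D.a i) = D.a i) (hb : ∀ g i, φ g (D.b i) = D.b i)
    (hf : ∀ g i z, D.f i (ψ i g z) = φ g (D.f i z)) (m : ℕ) :
    Representation.Equiv (Representation.directSum fun i => homologyRep (ψ i) m)
      (homologyRep φ (m + 1)) :=
  Representation.Equiv.mk
    (LinearEquiv.ofBijective (D.sumSusp m) ⟨D.sumSusp_injective m, D.sumSusp_surjective m⟩)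
    fun g => by
      refine DirectSum.linearMap_ext ℂ fun i => Submodule.linearMap_qext _
        (LinearMap.ext fun x => ?_)
      change D.sumSusp m (DirectSum.lmap (fun i => homologyRep (ψ i) m g)
          (DirectSum.lof ℂ ι (fun i => RedHomology (J i) m) i (Submodule.Quotient.mk x))) =
        homologyRep φ (m + 1) g (D.sumSusp m
          (DirectSum.lof ℂ ι (fun i => RedHomology (J i) m) i (Submodule.Quotient.mk x)))
      rw [DirectSum.lmap_lof, sumSusp, DirectSum.toModule_lof, DirectSum.toModule_lof]
      exact congrArg Submodule.Quotient.mk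
        (Subtype.ext (D.susp_chainRep φ ψ ha hb hf i m g x))

end ConeDecomposition

/-! ### Homology of the dual poset. -/

section Reversal

variable {X : Type*} [PartialOrder X] {Y : Type*} [PartialOrder Y]

/-- The image of a chain under an order-reversing bijection, listed increasingly. -/
def revChain (e : X ≃o Yᵒᵈ) {m : ℕ} (c : Fin m ↪o X) : Fin m ↪o Y :=
  OrderEmbedding.ofStrictMono (fun k => OrderDual.ofDual (e (c k.rev))) fun i j hij => by
    change e (c j.rev) < e (c i.rev)
    simpa using hij

theorem revChain_apply (e : X ≃o Yᵒᵈ) {m : ℕ} (c : Fin m ↪o X) (k : Fin m) :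
    revChain e c k = OrderDual.ofDual (e (c k.rev)) := rfl

/-- The map of chains induced by an order-reversing bijection. -/
noncomputable def revChains (e : X ≃o Yᵒᵈ) (m : ℕ) : OrderChains X m →ₗ[ℂ] OrderChains Y m :=
  (simplex X m).constr ℂ fun c => simplex Y m (revChain e c)

theorem revChains_simplex (e : X ≃o Yᵒᵈ) (m : ℕ) (c : Fin m ↪o X) :
    revChains e m (simplex X m c) = simplex Y m (revChain e c) :=
  Module.Basis.constr_basis _ _ _ _

theorem revChains_revChains (e : X ≃o Yᵒᵈ) (e' : Y ≃o Xᵒᵈ)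
    (h : ∀ x, e' (OrderDual.ofDual (e x)) = OrderDual.toDual x) (m : ℕ) (x : OrderChains X m) :
    revChains e' m (revChains e m x) = x := by
  refine LinearMap.congr_fun (simplex_ext (f := revChains e' m ∘ₗ revChains e m)
    (g := LinearMap.id) fun c => ?_) x
  rw [LinearMap.comp_apply, revChains_simplex, revChains_simplex, LinearMap.id_apply]
  congr 1
  ext k
  rw [revChain_apply, revChain_apply, h, Fin.rev_rev]
  rfl

theorem face_rev_revChain (e : X ≃o Yᵒᵈ) {m : ℕ} (i : Fin (m + 1)) (c : Fin (m + 1) ↪o X) :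
    face i.rev (revChain e c) = revChain e (face i c) := by
  ext k
  rw [face_apply, revChain_apply, revChain_apply, face_apply, Fin.rev_succAbove, Fin.rev_rev]

/-- Reversal turns the `i`-th face into the `(m - i)`-th, which changes the sign by `(-1) ^ m`. This
is not a chain map, but cycles and boundaries are still preserved. -/
theorem boundary_revChains (e : X ≃o Yᵒᵈ) (m : ℕ) (x : OrderChains X (m + 1)) :
    boundary Y m (revChains e (m + 1) x) = (-1 : ℂ) ^ m • revChains e m (boundary X m x) := by
  refine LinearMap.congr_fun (simplex_ext (f := boundary Y m ∘ₗ revChains e (m + 1))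
    (g := (-1 : ℂ) ^ m • (revChains e m ∘ₗ boundary X m)) fun c => ?_) x
  rw [LinearMap.comp_apply, LinearMap.smul_apply, LinearMap.comp_apply, revChains_simplex,
    boundary_simplex, boundary_simplex, map_sum, Finset.smul_sum,
    ← Equiv.sum_comp (Fin.revPerm (n := m + 1))]
  refine Finset.sum_congr rfl fun i _ => ?_
  rw [Fin.revPerm_apply, face_rev_revChain, map_smul, revChains_simplex, smul_smul]
  congr 1
  obtain ⟨k, hk⟩ := Nat.exists_eq_add_of_le (Nat.lt_succ_iff.1 i.2)
  have h : (i.rev : ℕ) = k := by rw [Fin.val_rev]; omega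
  have hm : (-1 : ℂ) ^ m = (-1) ^ (i : ℕ) * (-1) ^ k := by rw [← pow_add, ← hk]
  rw [h, hm, mul_right_comm, ← mul_pow, neg_one_mul, neg_neg, one_pow, one_mul]

theorem revChains_mem_cycles (e : X ≃o Yᵒᵈ) (m : ℕ) (x : OrderChains X m) (hx : x ∈ cycles X m) :
    revChains e m x ∈ cycles Y m := by
  cases m with
  | zero => exact Submodule.mem_top
  | succ m =>
    have hx' : boundary X m x = 0 := hx
    change boundary Y m _ = 0
    rw [boundary_revChains, hx', map_zero, smul_zero]

theorem revChains_mem_boundaries (e : X ≃o Yᵒᵈ) (m : ℕ) (x : OrderChains X m)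
    (hx : x ∈ boundaries X m) : revChains e m x ∈ boundaries Y m := by
  obtain ⟨y, rfl⟩ := hx
  refine ⟨(-1 : ℂ) ^ m • revChains e (m + 1) y, ?_⟩
  rw [map_smul, boundary_revChains, smul_smul, ← mul_pow, neg_one_mul, neg_neg, one_pow, one_smul]

/-- The map of homology induced by an order-reversing bijection. -/
noncomputable def homologyRev (e : X ≃o Yᵒᵈ) (m : ℕ) : RedHomology X m →ₗ[ℂ] RedHomology Y m :=
  Submodule.mapQ _ _ ((revChains e m).restrict (revChains_mem_cycles e m)) fun x hx =>
    revChains_mem_boundaries e m x hx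

theorem homologyRev_comp (e : X ≃o Yᵒᵈ) (e' : Y ≃o Xᵒᵈ)
    (h : ∀ x, e' (OrderDual.ofDual (e x)) = OrderDual.toDual x) (m : ℕ) :
    homologyRev e' m ∘ₗ homologyRev e m = LinearMap.id :=
  Submodule.linearMap_qext _ (LinearMap.ext fun x =>
    congrArg Submodule.Quotient.mk (Subtype.ext (revChains_revChains e e' h m x)))

/-- A poset and its dual have the same homology. -/
noncomputable def homologyDualEquiv {G : Type*} [Group G] (φ : G →* (X ≃o X)) (m : ℕ) :
    Representation.Equiv (homologyRep (dualAction φ) m) (homologyRep φ m) :=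
  Representation.Equiv.mk
    (LinearEquiv.ofLinearMap (homologyRev (OrderIso.refl Xᵒᵈ) m)
      (homologyRev (OrderIso.dualDual X) m)
      (homologyRev_comp _ _ (fun _ => rfl) m) (homologyRev_comp _ _ (fun _ => rfl) m))
    fun g => by
      refine Submodule.linearMap_qext _ (LinearMap.ext fun x =>
        congrArg Submodule.Quotient.mk (Subtype.ext ?_))
      refine LinearMap.congr_fun (simplex_ext
        (f := revChains (OrderIso.refl Xᵒᵈ) m ∘ₗ chainRep (dualAction φ) m g)
        (g := chainRep φ m g ∘ₗ revChains (OrderIso.refl Xᵒᵈ) m) fun c => ?_)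
        (x : OrderChains Xᵒᵈ m)
      rw [LinearMap.comp_apply, LinearMap.comp_apply, chainRep_simplex, revChains_simplex,
        revChains_simplex, chainRep_simplex]
      rfl

end Reversal

/-! ### Direct sums in the Grothendieck group, and the Lefschetz character of a shifted sum. -/

section VirtualReps

variable {G : Type v} [Group G]

theorem RepClass.mk_eq_mk {V W : Type u} [AddCommGroup V] [Module ℂ V] [Module.Finite ℂ V]
    [AddCommGroup W] [Module ℂ W] [Module.Finite ℂ W] {ρ : Representation ℂ G V}
    {σ : Representation ℂ G W} (e : ρ.Equiv σ) : RepClass.mk ρ = RepClass.mk σ :=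
  Quotient.sound ⟨e⟩

theorem RepClass.mk_prod {V W : Type u} [AddCommGroup V] [Module ℂ V] [Module.Finite ℂ V]
    [AddCommGroup W] [Module ℂ W] [Module.Finite ℂ W] (ρ : Representation ℂ G V)
    (σ : Representation ℂ G W) : RepClass.mk (ρ.prod σ) = RepClass.mk ρ + RepClass.mk σ := rfl

theorem RepClass.mk_eq_zero {V : Type u} [AddCommGroup V] [Module ℂ V] [Module.Finite ℂ V]
    [Subsingleton V] (ρ : Representation ℂ G V) : RepClass.mk ρ = 0 :=
  RepClass.mk_eq_mk (σ := (1 : Representation ℂ G PUnit.{u + 1}))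
    (Representation.Equiv.mk (LinearEquiv.ofSubsingleton V PUnit.{u + 1}) fun _ => by ext)

/-- The product of a family of representations. -/
def piRep {ι : Type} {V : ι → Type u} [∀ i, AddCommGroup (V i)] [∀ i, Module ℂ (V i)]
    (ρ : ∀ i, Representation ℂ G (V i)) : Representation ℂ G (∀ i, V i) where
  toFun g := LinearMap.pi fun i => ρ i g ∘ₗ LinearMap.proj i
  map_one' := by ext; simp
  map_mul' g h := by ext; simp

theorem RepClass.mk_piRep_fin (n : ℕ) {V : Fin n → Type u} [∀ i, AddCommGroup (V i)]
    [∀ i, Module ℂ (V i)] [∀ i, Module.Finite ℂ (V i)] (ρ : ∀ i, Representation ℂ G (V i)) :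
    RepClass.mk (piRep ρ) = ∑ i, RepClass.mk (ρ i) := by
  induction n with
  | zero => exact RepClass.mk_eq_zero _
  | succ n ih =>
    rw [Fin.sum_univ_succ, ← ih fun i => ρ i.succ, ← RepClass.mk_prod]
    refine (RepClass.mk_eq_mk (Representation.Equiv.mk (Fin.consLinearEquiv ℂ V) fun g => ?_)).symm
    refine LinearMap.ext fun x => funext fun i => ?_
    induction i using Fin.cases with
    | zero => rfl
    | succ i => rfl

theorem RepClass.mk_directSum {ι : Type} [Fintype ι] {V : ι → Type u} [∀ i, AddCommGroup (V i)]
    [∀ i, Module ℂ (V i)] [∀ i, Module.Finite ℂ (V i)] (ρ : ∀ i, Representation ℂ G (V i)) :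
    RepClass.mk (Representation.directSum ρ) = ∑ i, RepClass.mk (ρ i) := by
  classical
  let e := Fintype.equivFin ι
  rw [← Equiv.sum_comp e.symm, ← RepClass.mk_piRep_fin]
  refine RepClass.mk_eq_mk (Representation.Equiv.mk
    ((DirectSum.linearEquivFunOnFintype ℂ ι V).trans (LinearEquiv.piCongrLeft' ℂ V e)) fun g => ?_)
  refine LinearMap.ext fun x => funext fun i => ?_
  rfl

theorem VirtualRep.mk_eq_sum {ι : Type} [Fintype ι] {V : ι → Type u} [∀ i, AddCommGroup (V i)]
    [∀ i, Module ℂ (V i)] [∀ i, Module.Finite ℂ (V i)] (ρ : ∀ i, Representation ℂ G (V i))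
    {W : Type u} [AddCommGroup W] [Module ℂ W] [Module.Finite ℂ W] {σ : Representation ℂ G W}
    (e : (Representation.directSum ρ).Equiv σ) :
    VirtualRep.mk σ = ∑ i, VirtualRep.mk (ρ i) := by
  rw [VirtualRep.mk, ← RepClass.mk_eq_mk e, RepClass.mk_directSum]
  exact map_sum Algebra.GrothendieckAddGroup.of _ _

theorem VirtualRep.mk_eq_zero {V : Type u} [AddCommGroup V] [Module ℂ V] [Module.Finite ℂ V]
    [Subsingleton V] (ρ : Representation ℂ G V) : VirtualRep.mk ρ = 0 := by
  rw [VirtualRep.mk, RepClass.mk_eq_zero]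
  exact map_zero Algebra.GrothendieckAddGroup.of

theorem subsingleton_redHomology_of_card_lt {P : Type u} [PartialOrder P] [Finite P] {m : ℕ}
    (h : Nat.card P < m) : Subsingleton (RedHomology P m) := by
  have : IsEmpty (Fin m ↪o P) := ⟨fun c => by
    have := Nat.card_le_card_of_injective c c.injective
    rw [Nat.card_fin] at this
    omega⟩
  have : Subsingleton (OrderChains P m) := inferInstanceAs (Subsingleton ((Fin m ↪o P) →₀ ℂ))
  exact (Submodule.Quotient.mk_surjective _).subsingleton

/-- Lets characters of posets of different cardinalities be summed over one common range. -/
theorem lefschetz_eq_sum_range {P : Type u} [PartialOrder P] [Finite P] (φ : G →* (P ≃o P))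
    {N : ℕ} (hN : Nat.card P + 1 ≤ N) :
    lefschetz φ =
      ∑ m ∈ Finset.range N, (-1 : ℤ) ^ (m + 1) • VirtualRep.mk (homologyRep φ m) := by
  refine Finset.sum_subset (Finset.range_mono hN) fun m _ hm => ?_
  have := subsingleton_redHomology_of_card_lt (P := P) (m := m) (by
    rw [Finset.mem_range] at hm; omega)
  rw [VirtualRep.mk_eq_zero, smul_zero]

/-- If the homology of `P` is the direct sum of the homologies of the `J i`, shifted by one, then
the Lefschetz character of `P` is minus the sum of those of the `J i`. -/
theorem lefschetz_eq_neg_sum {P : Type u} [PartialOrder P] [Finite P] [Nonempty P]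
    (φ : G →* (P ≃o P)) {ι : Type} [Fintype ι] {J : ι → Type u} [∀ i, PartialOrder (J i)]
    [∀ i, Finite (J i)] (ψ : ∀ i, G →* (J i ≃o J i))
    (e : ∀ m, Nonempty (Representation.Equiv (Representation.directSum fun i => homologyRep (ψ i) m)
      (homologyRep φ (m + 1)))) :
    lefschetz φ = -∑ i, lefschetz (ψ i) := by
  let N := Nat.card P + ∑ i, Nat.card (J i) + 1
  have hN : ∀ i, Nat.card (J i) + 1 ≤ N := fun i => by
    have := Finset.single_le_sum (f := fun i => Nat.card (J i)) (fun _ _ => Nat.zero_le _)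
      (Finset.mem_univ i)
    simp only [N]
    omega
  -- The term in degree `-1` has no counterpart among the `J i`; it vanishes as `P` is nonempty.
  have := subsingleton_redHomology_zero (X := P)
  rw [lefschetz_eq_sum_range φ (N := N + 1) (by simp only [N]; omega), Finset.sum_range_succ',
    VirtualRep.mk_eq_zero, smul_zero, add_zero,
    Finset.sum_congr rfl fun i _ => lefschetz_eq_sum_range (ψ i) (hN i), Finset.sum_comm,
    ← Finset.sum_neg_distrib]
  refine Finset.sum_congr rfl fun m _ => ?_
  rw [VirtualRep.mk_eq_sum _ (e m).some, pow_succ, mul_neg_one, neg_smul, Finset.smul_sum]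

end VirtualReps

/-! ### Ranks in duals, truncations, chains and trees. -/

section Ranks

variable {P : Type u} [PartialOrder P]

theorem IsRankedOfLength.length_le {n : ℕ} (hP : IsRankedOfLength P n) (p : LTSeries P) :
    p.length ≤ n := by
  have hc : IsChain (· ≤ ·) (Set.range p) := by
    rintro _ ⟨i, rfl⟩ _ ⟨j, rfl⟩ -
    exact (le_total i j).imp (fun h => p.monotone h) fun h => p.monotone h
  obtain ⟨s, hs, hps⟩ := hc.exists_maxChain
  have h1 := Set.encard_le_encard hps
  rw [hP s hs, ← Set.image_univ, p.strictMono.injective.encard_image, Set.encard_univ,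
    ENat.card_eq_coe_natCard, Nat.card_fin] at h1
  exact Nat.le_of_succ_le_succ (by exact_mod_cast h1)

/-- Finite heights are strictly increasing along a chain, so height injects `s` into `{0, …, h}`. -/
theorem encard_le_height_add_one {x : P} {h : ℕ} (hx : Order.height x = h) {s : Set P}
    (hs : IsChain (· ≤ ·) s) (hsx : ∀ y ∈ s, y ≤ x) : s.encard ≤ h + 1 := by
  have hy : ∀ y ∈ s, Order.height y ≤ h := fun y hy => (Order.height_mono (hsx y hy)).trans hx.le
  have hf : ∀ y ∈ s, Order.height y < ⊤ := fun y hys =>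
    (hy y hys).trans_lt (ENat.natCast_lt_top h)
  have hinj : Set.InjOn (fun y => (Order.height y).toNat) s := by
    intro y hys z hzs hyz
    have e : Order.height y = Order.height z := by
      rw [← ENat.natCast_toNat (hf y hys).ne, ← ENat.natCast_toNat (hf z hzs).ne]
      exact congrArg _ hyz
    by_contra hne
    rcases hs hys hzs hne with hle | hle
    · exact (Order.height_strictMono (hle.lt_of_ne hne) (hf y hys)).ne e
    · exact (Order.height_strictMono (hle.lt_of_ne' hne) (hf z hzs)).ne e.symm
  have hmaps : Set.MapsTo (fun y => (Order.height y).toNat) s (Finset.range (h + 1) : Set ℕ) := by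
    intro y hys
    rw [Finset.mem_coe, Finset.mem_range, Nat.lt_succ_iff]
    exact ENat.toNat_le_of_le_natCast (hy y hys)
  refine (Set.encard_le_encard_of_injOn hmaps hinj).trans ?_
  rw [Set.encard_coe_eq_coe_finsetCard, Finset.card_range]
  exact le_rfl

/-- Joining longest chains below and above `x` gives at most `n`. Conversely, a maximal chain
through `x` has `n + 1` elements and is cut by `x` into two parts that share only `x`. -/
theorem IsRankedOfLength.height_add_coheight [Finite P] {n : ℕ} (hP : IsRankedOfLength P n)
    (x : P) : Order.height x + Order.coheight x = n := by
  have h1 : Order.height x ≤ n := Order.height_le fun p _ => by exact_mod_cast hP.length_le p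
  have h2 : Order.coheight x ≤ n := Order.coheight_le fun p _ => by exact_mod_cast hP.length_le p
  obtain ⟨h, hh⟩ := ENat.ne_top_iff_exists.1 (h1.trans_lt (ENat.natCast_lt_top n)).ne
  obtain ⟨c, hc⟩ := ENat.ne_top_iff_exists.1 (h2.trans_lt (ENat.natCast_lt_top n)).ne
  refine le_antisymm ?_ ?_
  · obtain ⟨p, hp, hpl⟩ := Order.exists_series_of_le_height x hh.le
    obtain ⟨q, hq, hql⟩ := Order.exists_series_of_le_coheight x hc.le
    have := hP.length_le (p.smash q (hp.trans hq.symm))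
    rw [RelSeries.smash_length, hpl, hql] at this
    rw [← hh, ← hc]
    exact_mod_cast this
  · obtain ⟨s, hs, hxs⟩ := (IsChain.singleton (r := (· ≤ ·)) (a := x)).exists_maxChain
    have hx : x ∈ s := hxs rfl
    have hxc : ∀ y ∈ s, y ≤ x ∨ x ≤ y := fun y hy => hs.isChain.total hy hx
    have e : s ∩ Set.Iic x ∪ s ∩ Set.Ici x = s := by
      rw [← Set.inter_union_distrib_left]
      exact Set.inter_eq_left.2 hxc
    have e' : s ∩ Set.Iic x ∩ (s ∩ Set.Ici x) = {x} := by
      ext y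
      simp only [Set.mem_inter_iff, Set.mem_Iic, Set.mem_Ici, Set.mem_singleton_iff]
      exact ⟨fun h => le_antisymm h.1.2 h.2.2, by rintro rfl; exact ⟨⟨hx, le_rfl⟩, hx, le_rfl⟩⟩
    have h1 := encard_le_height_add_one hh.symm (hs.isChain.mono Set.inter_subset_left)
      fun y hy => hy.2
    have h2 := encard_le_height_add_one (P := Pᵒᵈ) (x := OrderDual.toDual x) (h := c)
      (s := OrderDual.ofDual ⁻¹' (s ∩ Set.Ici x)) hc.symm
      (fun y hy z hz hyz => (hs.isChain hz.1 hy.1 hyz.symm)) fun y hy => hy.2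
    have h3 := Set.encard_union_add_encard_inter (s ∩ Set.Iic x) (s ∩ Set.Ici x)
    rw [e, e', hP s hs, Set.encard_singleton] at h3
    have h4 := h3.trans_le (add_le_add h1 h2)
    rw [← hh, ← hc]
    have h5 : n + 1 + 1 ≤ (h + 1) + (c + 1) := by exact_mod_cast h4
    exact_mod_cast (by omega : n ≤ h + c)

theorem IsRankedOfLength.rank_toDual_add [Finite P] {n : ℕ} (hP : IsRankedOfLength P n) (x : P) :
    rank (OrderDual.toDual x) + rank x = n := by
  have h := hP.height_add_coheight x
  rw [rank, rank, Order.height_toDual, add_comm, ← ENat.toNat_add, h, ENat.toNat_natCast]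
  · exact ((le_self_add.trans h.le).trans_lt (ENat.natCast_lt_top n)).ne
  · exact ((le_add_self.trans h.le).trans_lt (ENat.natCast_lt_top n)).ne

/-- `P` is its truncation with a minimum put back, which raises every height by one. -/
theorem rank_trunc_add_one [BoundedOrder P] [Finite P] {n : ℕ} (hP : IsRankedOfLength P n)
    (x : Trunc P) : rank x + 1 = rank (x : P) := by
  classical
  have h : Order.height (x : P) = Order.height x + 1 :=
    (Order.height_orderIso (WithBot.subtypeOrderIso (α := P)) (x : WithBot (Trunc P))).trans
      (Order.height_coe_withBot x)
  have hf : Order.height x ≠ ⊤ := fun h' => by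
    have h2 := hP.height_add_coheight (x : P)
    rw [h, h', top_add, top_add] at h2
    exact ENat.top_ne_natCast n h2
  rw [rank, rank, h, ENat.toNat_add hf ENat.one_ne_top, ENat.toNat_one]

end Ranks

theorem natCast_le_height_of_strictMono {P : Type*} [Preorder P] {k : ℕ} {g : Fin (k + 1) → P}
    (hg : StrictMono g) : (k : ℕ∞) ≤ Order.height (g (Fin.last k)) :=
  Order.length_le_height_last (p := LTSeries.mk k g hg)

theorem rank_fin {n : ℕ} (i : Fin n) : rank i = i := by
  have h : Order.height i = (i : ℕ) := by
    refine le_antisymm ?_ ?_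
    · rw [← Order.height_nat]
      exact Order.height_le_height_apply_of_strictMono (fun i : Fin n => (i : ℕ))
        (fun _ _ h => h) i
    · exact natCast_le_height_of_strictMono
        (g := fun k : Fin (i + 1) => (⟨k, k.is_le.trans_lt i.2⟩ : Fin n)) fun _ _ h => h
  rw [rank, h, ENat.toNat_natCast]

theorem rank_tree {t n : ℕ} (w : Tree t n) : rank w = w.1.length := by
  have h : Order.height w = w.1.length := by
    refine le_antisymm ?_ ?_
    · rw [← Order.height_nat]
      refine Order.height_le_height_apply_of_strictMono (fun w : Tree t n => w.1.length) ?_ w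
      intro a b hab
      refine lt_of_le_of_ne (List.IsPrefix.length_le hab.le) fun h => hab.ne ?_
      exact Subtype.ext (List.IsPrefix.eq_of_length hab.le h)
    · let g : Fin (w.1.length + 1) → Tree t n := fun k =>
        ⟨w.1.take k, (List.length_take_le' _ _).trans w.2⟩
      have hg : StrictMono g := by
        intro i j hij
        have hij' : (i : ℕ) < j := hij
        refine lt_of_le_of_ne (List.take_prefix_take_left hij'.le) fun h => ?_
        have h' := congrArg (fun w : Tree t n => w.1.length) h
        simp only [g, List.length_take] at h'
        omega
      have hl : g (Fin.last w.1.length) = w := Subtype.ext List.take_length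
      exact (natCast_le_height_of_strictMono hg).trans_eq (congrArg _ hl)
  rw [rank, h, ENat.toNat_natCast]

/-! ### Words -/

/-- The index set of the nonempty words of length at most `n` in `t` letters. -/
abbrev WordIndex (t n : ℕ) : Type := (j : Finset.Icc 1 n) × Fin (t ^ (j : ℕ))

/-- The word with a given index. -/
def WordIndex.word {t n : ℕ} (i : WordIndex t n) : List (Fin t) :=
  List.ofFn (finFunctionFinEquiv.symm i.2)

namespace WordIndex

variable {t n : ℕ}

theorem length_word (i : WordIndex t n) : i.word.length = i.1 := List.length_ofFn

theorem one_le (i : WordIndex t n) : 1 ≤ (i.1 : ℕ) := (Finset.mem_Icc.1 i.1.2).1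

theorem le (i : WordIndex t n) : (i.1 : ℕ) ≤ n := (Finset.mem_Icc.1 i.1.2).2

theorem word_injective : Function.Injective (word : WordIndex t n → List (Fin t)) := by
  rintro ⟨j, k⟩ ⟨j', k'⟩ h
  have hj : j = j' := Subtype.ext (by
    simpa only [length_word] using congrArg List.length h)
  subst hj
  have h' := finFunctionFinEquiv.symm.injective (List.ofFn_injective h)
  exact congrArg _ h'

theorem exists_word {w : List (Fin t)} (h : w ≠ []) (hw : w.length ≤ n) :
    ∃ i : WordIndex t n, i.word = w :=
  ⟨⟨⟨w.length, Finset.mem_Icc.2 ⟨List.length_pos_iff.2 h, hw⟩⟩, finFunctionFinEquiv w.get⟩, by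
    simp only [word, Equiv.symm_apply_apply, List.ofFn_get]⟩

/-- Telescoping along the prefixes of `w`. -/
theorem sum_prefix {M : Type*} [AddCommGroup M] (F : List (Fin t) → M) (w : List (Fin t))
    (hw : w.length ≤ n) :
    ∑ i : WordIndex t n, (if i.word <+: w then F i.word - F i.word.dropLast else 0) =
      F w - F [] := by
  induction w using List.reverseRecOn with
  | nil =>
    rw [sub_self]
    refine Finset.sum_eq_zero fun i _ => if_neg fun h => ?_
    have := i.length_word ▸ i.one_le
    rw [List.prefix_nil.1 h] at this
    simp at this
  | append_singleton w x ih =>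
    obtain ⟨k, hk⟩ := exists_word (n := n) (w := w ++ [x]) (by simp) hw
    have hw' : w.length ≤ n := by
      rw [List.length_append] at hw; omega
    -- The only prefix of `w ++ [x]` that is not a prefix of `w` is the whole word, which
    -- contributes the last edge of the path.
    have e : ∀ i : WordIndex t n,
        (if i.word <+: w ++ [x] then F i.word - F i.word.dropLast else 0) =
          (if i = k then F i.word - F i.word.dropLast else 0) +
            if i.word <+: w then F i.word - F i.word.dropLast else 0 := by
      intro i
      have h1 : i = k ↔ i.word = w ++ [x] := by rw [← hk, word_injective.eq_iff]
      simp only [List.prefix_concat_iff, h1]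
      by_cases h2 : i.word = w ++ [x]
      · have h3 : ¬ i.word <+: w := fun h => by
          have := h.length_le
          rw [h2, List.length_append, List.length_singleton] at this
          omega
        rw [if_pos (Or.inl h2), if_pos h2, if_neg h3, add_zero]
      · simp only [h2, false_or, if_false, zero_add]
    rw [Finset.sum_congr rfl fun i _ => e i, Finset.sum_add_distrib, ih hw', Finset.sum_ite_eq',
      if_pos (Finset.mem_univ k), hk, List.dropLast_concat, sub_add_sub_cancel]

end WordIndex

/-! ### The tree product -/

namespace TreeProduct

variable {P : Type u} [PartialOrder P] [BoundedOrder P] {t n : ℕ}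

/-- The component in `P` of an element of the dual of `(P^* * T_{t,n})⁻`. -/
def pt (y : (TreeProduct P t n)ᵒᵈ) : P := OrderDual.ofDual (OrderDual.ofDual y).1.fst

/-- The word of an element of the dual of `(P^* * T_{t,n})⁻`. -/
def wd (y : (TreeProduct P t n)ᵒᵈ) : List (Fin t) := (OrderDual.ofDual y).1.snd.1

theorem ext {x y : (TreeProduct P t n)ᵒᵈ} (hp : pt x = pt y) (hw : wd x = wd y) : x = y :=
  Subtype.ext (Rees.ext hp (Subtype.ext hw))

theorem wd_length_le (y : (TreeProduct P t n)ᵒᵈ) : (wd y).length ≤ n :=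
  (OrderDual.ofDual y).1.snd.2

variable [Finite P]

theorem length_add_rank_le (hP : IsRankedOfLength P n) (y : (TreeProduct P t n)ᵒᵈ) :
    (wd y).length + rank (pt y) ≤ n := by
  have h1 := (OrderDual.ofDual y).1.rank_le
  rw [rank_tree] at h1
  exact (Nat.add_le_add_right h1 _).trans_eq (hP.rank_toDual_add (pt y))

/-- The rank in the dual is `n - rank`, which turns the Rees condition into monotonicity of `|w| +
rank p`. -/
theorem le_iff (hP : IsRankedOfLength P n) {x y : (TreeProduct P t n)ᵒᵈ} :
    x ≤ y ↔ pt x ≤ pt y ∧ wd y <+: wd x ∧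
      (wd x).length + rank (pt x) ≤ (wd y).length + rank (pt y) := by
  have hx := hP.rank_toDual_add (pt x)
  have hy := hP.rank_toDual_add (pt y)
  have h : x ≤ y ↔ pt x ≤ pt y ∧ wd y <+: wd x ∧
      (rank (OrderDual.ofDual x).1.snd : ℤ) - rank (OrderDual.ofDual y).1.snd ≤
        (rank (OrderDual.toDual (pt x)) : ℤ) - rank (OrderDual.toDual (pt y)) := Iff.rfl
  rw [h, rank_tree, rank_tree]
  change _ ∧ _ ∧ ((wd x).length : ℤ) - (wd y).length ≤ _ ↔ _
  refine and_congr_right fun _ => and_congr_right fun _ => ?_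
  omega

/-- With equal points of `P`, the rank condition and the prefix relation force the words to be
equal. -/
theorem pt_lt_pt (hP : IsRankedOfLength P n) {x y : (TreeProduct P t n)ᵒᵈ} (h : x < y) :
    pt x < pt y := by
  have h' := (le_iff hP).1 h.le
  refine h'.1.lt_of_ne fun e => h.ne (ext e ?_)
  rw [e] at h'
  exact (h'.2.1.eq_of_length (le_antisymm h'.2.1.length_le (by omega))).symm

/-- The element with given components. -/
def mk (hP : IsRankedOfLength P n) (p : P) (w : List (Fin t)) (hp : p ≠ ⊤)
    (hw : w.length + rank p ≤ n) :
    (TreeProduct P t n)ᵒᵈ :=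
  OrderDual.toDual ⟨⟨OrderDual.toDual p, ⟨w, by omega⟩, by
    have := hP.rank_toDual_add p
    refine (rank_tree _).trans_le (show w.length ≤ _ from ?_)
    omega⟩, fun h => hp (congrArg (fun a : Rees Pᵒᵈ (Tree t n) => OrderDual.ofDual a.fst) h)⟩

theorem pt_mk (hP : IsRankedOfLength P n) (p : P) (w : List (Fin t)) (hp : p ≠ ⊤)
    (hw : w.length + rank p ≤ n) :
    pt (mk hP p w hp hw) = p := rfl

theorem wd_mk (hP : IsRankedOfLength P n) (p : P) (w : List (Fin t)) (hp : p ≠ ⊤)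
    (hw : w.length + rank p ≤ n) :
    wd (mk hP p w hp hw) = w := rfl

theorem rank_top (hP : IsRankedOfLength P n) : rank (⊤ : P) = n := by
  have h := hP.rank_toDual_add (⊤ : P)
  have h' : rank (OrderDual.toDual (⊤ : P)) = 0 := rank_bot
  omega

theorem bot_ne_top (hP : IsRankedOfLength P n) (hn : 1 ≤ n) : (⊥ : P) ≠ ⊤ := fun h => by
  have := rank_top hP
  rw [← h, rank_bot] at this
  omega

/-- The element whose components are the minimum of `P` and the word `w`, cut to length `n`. -/
def apex (hP : IsRankedOfLength P n) (hn : 1 ≤ n) (w : List (Fin t)) : (TreeProduct P t n)ᵒᵈ :=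
  -- Cutting makes the apex a total function of words, as the telescoping sum requires.
  mk hP ⊥ (w.take n) (bot_ne_top hP hn) (by rw [rank_bot]; exact List.length_take_le _ _)

theorem pt_apex (hP : IsRankedOfLength P n) (hn : 1 ≤ n) (w : List (Fin t)) : pt
    (apex hP hn w) = ⊥ := rfl

theorem wd_apex (hP : IsRankedOfLength P n) (hn : 1 ≤ n) {w : List (Fin t)} (hw : w.length ≤ n) :
    wd (apex hP hn w) = w :=
  List.take_of_length_le hw

theorem apex_le_iff (hP : IsRankedOfLength P n) (hn : 1 ≤ n) {w : List (Fin t)} (hw : w.length ≤ n)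
    {y : (TreeProduct P t n)ᵒᵈ} :
    apex hP hn w ≤ y ↔ wd y <+: w ∧ w.length ≤ (wd y).length + rank (pt y) := by
  rw [le_iff hP, wd_apex hP hn hw, pt_apex, rank_bot, add_zero]
  exact and_iff_right bot_le

theorem apex_lt_iff (hP : IsRankedOfLength P n) (hn : 1 ≤ n) {w : List (Fin t)} (hw : w.length ≤ n)
    {y : (TreeProduct P t n)ᵒᵈ} :
    apex hP hn w < y ↔
      pt y ≠ ⊥ ∧ wd y <+: w ∧ w.length ≤ (wd y).length + rank (pt y) := by
  rw [← apex_le_iff hP hn hw]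
  refine ⟨fun h => ⟨(pt_lt_pt hP h).ne', h.le⟩, fun h => h.2.lt_of_ne fun e => h.1 ?_⟩
  rw [← e, pt_apex]

end TreeProduct

/-! ### The ideals -/

namespace openIdeal

variable {P : Type u} [PartialOrder P] [BoundedOrder P] {n j : ℕ}

/-- The component in `P` of an element of `I_j(P)`. -/
def pt (z : openIdeal P n j) : P := z.1.fst

/-- The second component of an element of `I_j(P)`. -/
def ht (z : openIdeal P n j) : ℕ := z.1.snd

theorem ext {x y : openIdeal P n j} (hp : pt x = pt y) (hh : ht x = ht y) : x = y :=
  Subtype.ext (Rees.ext (Subtype.ext hp) (Fin.ext hh))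

variable [Finite P]

theorem rees_le_iff (hP : IsRankedOfLength P n) {x y : Rees (Trunc P) (Fin n)} :
    x ≤ y ↔ (x.fst : P) ≤ y.fst ∧ (x.snd : ℕ) ≤ y.snd ∧
      (y.snd : ℕ) + rank (x.fst : P) ≤ x.snd + rank (y.fst : P) := by
  have h : x ≤ y ↔ (x.fst : P) ≤ y.fst ∧ (x.snd : ℕ) ≤ y.snd ∧
      (rank y.snd : ℤ) - rank x.snd ≤ (rank y.fst : ℤ) - rank x.fst := Iff.rfl
  rw [h, rank_fin, rank_fin, ← rank_trunc_add_one hP, ← rank_trunc_add_one hP]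
  refine and_congr_right fun _ => and_congr_right fun _ => ?_
  omega

theorem le_iff (hP : IsRankedOfLength P n) {x y : openIdeal P n j} :
    x ≤ y ↔ pt x ≤ pt y ∧ ht x ≤ ht y ∧ ht y + rank (pt x) ≤ ht x + rank (pt y) :=
  rees_le_iff hP

/-- The inequality is strict because ranks in the truncation are one smaller than in `P`. -/
theorem ht_lt_rank (hP : IsRankedOfLength P n) (z : openIdeal P n j) : ht z < rank (pt z) := by
  have h := z.1.rank_le
  have h' := rank_trunc_add_one hP z.1.fst
  rw [rank_fin] at h
  change (z.1.snd : ℕ) < rank (z.1.fst : P)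
  omega

theorem ht_le (hP : IsRankedOfLength P n) (z : openIdeal P n j) : ht z ≤ j ∧ j + rank
    (pt z) ≤ ht z + n := by
  obtain ⟨w, hw, hj, hz⟩ := z.2
  have h := (rees_le_iff hP).1 hz.le
  rw [hw, hj, TreeProduct.rank_top hP] at h
  exact h.2

/-- At `⊤` the bounds force height `j`, so `z` would be the generator, which the open ideal omits.
-/
theorem pt_ne_top (hP : IsRankedOfLength P n) (z : openIdeal P n j) : pt z ≠ ⊤ := by
  obtain ⟨w, hw, hj, hz⟩ := z.2
  intro h
  have h1 := ht_le hP z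
  rw [h, TreeProduct.rank_top hP] at h1
  refine hz.ne (Rees.ext (Subtype.ext (h.trans hw.symm)) (Fin.ext ?_))
  change ht z = w.snd
  omega

/-- Converse of the preceding bounds: they describe `I_j(P)` completely. -/
theorem exists_mk (hP : IsRankedOfLength P n) (hn : 1 ≤ n) (hj : j < n) {p : P} {i : ℕ}
    (hp : p ≠ ⊤) (hi : i < rank p)
    (hij : i ≤ j) (hr : j + rank p ≤ i + n) : ∃ z : openIdeal P n j, pt z = p ∧ ht z = i := by
  have hb : p ≠ ⊥ := by
    rintro rfl
    rw [rank_bot] at hi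
    omega
  have ht : (⊤ : P) ≠ ⊥ := (TreeProduct.bot_ne_top hP hn).symm
  have hpt := rank_trunc_add_one hP ⟨p, hb⟩
  have htt := rank_trunc_add_one hP ⟨⊤, ht⟩
  rw [TreeProduct.rank_top hP] at htt
  let z : Rees (Trunc P) (Fin n) := ⟨⟨p, hb⟩, ⟨i, by omega⟩, by
    rw [rank_fin]
    change i ≤ _
    have : ((⟨p, hb⟩ : Trunc P) : P) = p := rfl
    rw [this] at hpt
    omega⟩
  let w : Rees (Trunc P) (Fin n) := ⟨⟨⊤, ht⟩, ⟨j, hj⟩, by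
    rw [rank_fin]
    change j ≤ _
    omega⟩
  have hzw : z ≤ w := (rees_le_iff hP).2 ⟨le_top, hij, by
    rw [show (w.fst : P) = ⊤ from rfl, TreeProduct.rank_top hP]
    exact hr⟩
  exact ⟨⟨z, w, rfl, rfl, hzw.lt_of_ne fun h =>
    hp (congrArg (fun a : Rees (Trunc P) (Fin n) => (a.fst : P)) h)⟩, rfl, rfl⟩

end openIdeal

/-! ### The ideals inside the tree product, and the resulting decomposition. -/

variable {P : Type u} [PartialOrder P] [BoundedOrder P] [Finite P] {t n : ℕ}

/-- Neither the natural subtraction nor `take` truncates here, since `ht z ≤ |v| - 1`. -/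
theorem openIdeal.length_take_word (hP : IsRankedOfLength P n) (i : WordIndex t n)
    (z : openIdeal P n ((i.1 : ℕ) - 1)) :
    (i.word.take (i.1 - 1 - ht z)).length + ht z + 1 = i.1 := by
  have h1 := ht_le hP z
  have h2 := i.length_word
  have h3 := i.one_le
  rw [List.length_take]
  omega

/-- The ideal `I_{|v| - 1}(P)` as a subposet of the dual of `(P^* * T_{t,n})⁻`, for a word `v`: the
second component is replaced by a prefix of `v`. -/
def openIdeal.embed (hP : IsRankedOfLength P n) (i : WordIndex t n) :
    openIdeal P n ((i.1 : ℕ) - 1) ↪o (TreeProduct P t n)ᵒᵈ :=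
  OrderEmbedding.ofMapLEIff
    (fun z => TreeProduct.mk hP (pt z) (i.word.take (i.1 - 1 - ht z)) (pt_ne_top hP z) (by
      have h1 := ht_le hP z
      have h2 := length_take_word hP i z
      omega))
    fun x y => by
      have hx := length_take_word hP i x
      have hy := length_take_word hP i y
      rw [TreeProduct.le_iff hP, le_iff hP]
      simp only [TreeProduct.pt_mk, TreeProduct.wd_mk]
      refine and_congr_right fun _ => ?_
      -- Prefixes of the same word are compared by length alone, and a smaller height means a longer
      -- prefix.
      constructor
      · rintro ⟨h1, h2⟩
        have := h1.length_le
        omega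
      · rintro ⟨h1, h2⟩
        exact ⟨List.take_prefix_take_left (by omega), by omega⟩

theorem openIdeal.pt_embed (hP : IsRankedOfLength P n) (i : WordIndex t n)
    (z : openIdeal P n ((i.1 : ℕ) - 1)) : TreeProduct.pt (embed hP i z) = pt z := rfl

theorem openIdeal.wd_embed (hP : IsRankedOfLength P n) (i : WordIndex t n)
    (z : openIdeal P n ((i.1 : ℕ) - 1)) :
    TreeProduct.wd (embed hP i z) = i.word.take (i.1 - 1 - ht z) := rfl

theorem openIdeal.mem_range_embed (hP : IsRankedOfLength P n) (hn : 1 ≤ n) (i : WordIndex t n)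
    {y : (TreeProduct P t n)ᵒᵈ} (h : TreeProduct.apex hP hn i.word < y)
    (h' : ¬ i.word <+: TreeProduct.wd y) : y ∈ Set.range (embed hP i) := by
  have hi := i.length_word
  have hi1 := i.one_le
  have hin := i.le
  obtain ⟨-, h2, h3⟩ := (TreeProduct.apex_lt_iff hP hn (hi.trans_le hin)).1 h
  have hl : (TreeProduct.wd y).length < i.word.length :=
    h2.length_le.lt_of_ne fun e => h' (h2.eq_of_length e ▸ List.prefix_rfl)
  have h4 := TreeProduct.length_add_rank_le hP y
  obtain ⟨z, hz1, hz2⟩ := exists_mk hP hn (j := (i.1 : ℕ) - 1) (by omega)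
    (p := TreeProduct.pt y) (i := i.1 - 1 - (TreeProduct.wd y).length)
    -- A point over `⊤` has rank `n`, hence the empty word; it would be the minimum of the Rees
    -- product, which was removed.
    (fun h => (OrderDual.ofDual y).2 (by
      rw [h, TreeProduct.rank_top hP] at h4
      have h0 : (TreeProduct.wd y).length = 0 := by omega
      exact Rees.ext h (Subtype.ext (List.length_eq_zero_iff.1 h0))))
    (by omega) (by omega) (by omega)
  refine ⟨z, TreeProduct.ext hz1 ?_⟩
  rw [wd_embed, hz2, show (i.1 : ℕ) - 1 - (i.1 - 1 - (TreeProduct.wd y).length) =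
    (TreeProduct.wd y).length by omega]
  exact (List.prefix_iff_eq_take.1 h2).symm

/-- Covers both ends of an edge: the prefix used by `embed` misses at least the last letter of `v`,
so it is a prefix of `v` and of `v.dropLast` alike. -/
theorem openIdeal.apex_lt_embed (hP : IsRankedOfLength P n) (hn : 1 ≤ n) (i : WordIndex t n)
    (z : openIdeal P n ((i.1 : ℕ) - 1)) {w : List (Fin t)} (hw : w <+: i.word)
    (hw' : (i.1 : ℕ) ≤ w.length + 1) : TreeProduct.apex hP hn w < embed hP i z := by
  have hi := i.length_word
  have hin := i.le
  have h1 := ht_lt_rank hP z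
  have h2 := length_take_word hP i z
  have h3 := hw.length_le
  rw [TreeProduct.apex_lt_iff hP hn (by omega), pt_embed, wd_embed]
  refine ⟨fun h => ?_, ?_, by omega⟩
  · rw [h, rank_bot] at h1
    omega
  · exact List.prefix_of_prefix_length_le (List.take_prefix _ _) hw (by omega)

/-- The decomposition of the dual of `(P^* * T_{t,n})⁻` into suspensions of the ideals
`I_{|v| - 1}(P)`, for the nonempty words `v`. -/
def TreeProduct.coneDecomposition (hP : IsRankedOfLength P n) (hn : 1 ≤ n) :
    ConeDecomposition (TreeProduct P t n)ᵒᵈ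
      fun i : WordIndex t n => openIdeal P n ((i.1 : ℕ) - 1) where
  t y := apex hP hn (wd y)
  o := apex hP hn []
  a i := apex hP hn i.word
  b i := apex hP hn i.word.dropLast
  U i := {y | i.word <+: wd y}
  f i := openIdeal.embed hP i
  t_le y := (apex_le_iff hP hn (wd_length_le y)).2 ⟨List.prefix_rfl, Nat.le_add_right _ _⟩
  t_ne x y h e := by
    have h' := pt_lt_pt hP h
    rw [← e, pt_apex] at h'
    exact not_lt_bot h'
  lower i x y h hy := List.IsPrefix.trans hy ((le_iff hP).1 h.le).2.1
  a_lt i z := openIdeal.apex_lt_embed hP hn i z List.prefix_rfl (by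
    have := i.length_word
    omega)
  b_lt i z := openIdeal.apex_lt_embed hP hn i z (List.dropLast_prefix _) (by
    have := i.length_word
    rw [List.length_dropLast]
    omega)
  range_f i x y hx hxy := by
    refine ⟨?_, fun hy => openIdeal.mem_range_embed hP hn i ?_ hy⟩
    · rintro ⟨z, rfl⟩ h
      have h1 : i.word.length ≤ _ := List.IsPrefix.length_le h
      have h2 := openIdeal.length_take_word hP i z
      have h3 := i.length_word
      rw [openIdeal.wd_embed] at h1
      omega
    · have h := (le_iff hP).1 hxy.le
      have hx' : i.word <+: wd x := hx
      refine (apex_lt_iff hP hn (i.length_word.trans_le i.le)).2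
        ⟨(pt_lt_pt hP hxy).ne_bot, ?_, by have := hx'.length_le; omega⟩
      -- The words `wd y` and `v` are both prefixes of `wd x`, hence comparable, and `v` is not a
      -- prefix of `wd y`.
      exact (List.prefix_or_prefix_of_prefix h.2.1 hx').resolve_right hy
  a_mem i k := by
    have hi := i.length_word.trans_le i.le
    change k.word <+: wd (apex hP hn i.word) ↔
      k.word <+: wd (apex hP hn i.word.dropLast) ∨ i = k
    rw [wd_apex hP hn hi,
      wd_apex hP hn ((List.dropLast_prefix _).length_le.trans hi)]
    have hne : i.word ≠ [] := fun h => by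
      have h1 := i.length_word
      have h2 := i.one_le
      rw [h, List.length_nil] at h1
      omega
    -- A prefix of `v` is either `v` itself or a prefix of `v.dropLast`.
    conv_lhs => rw [← List.dropLast_append_getLast hne]
    rw [List.prefix_concat_iff, List.dropLast_append_getLast hne, or_comm,
      WordIndex.word_injective.eq_iff, eq_comm (a := k)]
  b_notMem i h := by
    have hi := i.length_word
    have h1 : i.word <+: wd (apex hP hn i.word.dropLast) := h
    rw [wd_apex hP hn ((List.dropLast_prefix _).length_le.trans (hi.trans_le i.le))] at h1
    have h2 := h1.length_le
    have h3 := i.one_le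
    rw [List.length_dropLast] at h2
    omega
  t_sub_o x := by
    rw [← WordIndex.sum_prefix (n := n)
      (fun w => Finsupp.single (apex hP hn w : (TreeProduct P t n)ᵒᵈ) (1 : ℂ)) _ (wd_length_le x)]
    refine Finset.sum_congr rfl fun i _ => ?_
    by_cases h : i.word <+: wd x
    · rw [Set.indicator_of_mem (s := {y | i.word <+: wd y}) h, if_pos h, Pi.one_apply, one_smul]
    · rw [Set.indicator_of_notMem (s := {y | i.word <+: wd y}) h, if_neg h, zero_smul]

/-- The homology of `(P^* * T_{t,n})⁻` in terms of the homology of the ideals `I_j(P)`. This holds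
in every degree, whether or not `P` is Cohen-Macaulay. -/
theorem TreeProduct.nonempty_homologyEquiv {G : Type v} [Group G] (φ : G →* (P ≃o P))
    (hP : IsRankedOfLength P n) (hn : 1 ≤ n) (m : ℕ) :
    Nonempty (Representation.Equiv
      (Representation.directSum fun i : WordIndex t n =>
        homologyRep (openIdealAction φ n ((i.1 : ℕ) - 1)) m)
      (homologyRep (treeProductAction φ t n) (m + 1))) := by
  -- The group fixes `⊥` and does not move words, so it fixes every apex.
  have hφ : ∀ g (w : List (Fin t)),
      dualAction (treeProductAction φ t n) g (apex hP hn w) = apex hP hn w := fun g w =>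
    ext (map_bot (φ g)) rfl
  exact ⟨((coneDecomposition hP hn).homologyEquiv (dualAction (treeProductAction φ t n))
    (fun i => openIdealAction φ n ((i.1 : ℕ) - 1)) (fun g i => hφ g _) (fun g i => hφ g _)
    (fun g i z => ext rfl rfl) m).trans (homologyDualEquiv _ _)⟩

end ReesTree

theorem theorem4p5 {G : Type*} [Group G] {P : Type*} [PartialOrder P] [BoundedOrder P] [Finite P]
    (φ : G →* (P ≃o P)) (n : ℕ) (hn : 1 ≤ n) (hP : ReesTree.IsRankedOfLength P n)
    (t : ℕ) (ht : 1 ≤ t) :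
    (∑ j ∈ Finset.Icc 1 n, t ^ j • ReesTree.lefschetz (ReesTree.openIdealAction φ n (j - 1)) =
      -ReesTree.lefschetz (ReesTree.treeProductAction φ t n)) ∧
    (ReesTree.IsCohenMacaulay P →
      Nonempty (Representation.Equiv
        -- the direct sum, over `1 ≤ j ≤ n`, of `t ^ j` copies of the degree `n - 2` homology
        (Representation.directSum fun i : (j : Finset.Icc 1 n) × Fin (t ^ (j : ℕ)) =>
          ReesTree.homologyRep (ReesTree.openIdealAction φ n ((i.1 : ℕ) - 1)) (n - 1))
        -- the homology in degree `n - 1`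
        (ReesTree.homologyRep (ReesTree.treeProductAction φ t n) n))) := by
  constructor
  · have : Nonempty (ReesTree.TreeProduct P t n) :=
      ⟨OrderDual.ofDual (ReesTree.TreeProduct.apex hP hn [])⟩
    rw [ReesTree.lefschetz_eq_neg_sum (ReesTree.treeProductAction φ t n)
      (fun i : ReesTree.WordIndex t n => ReesTree.openIdealAction φ n ((i.1 : ℕ) - 1))
      (ReesTree.TreeProduct.nonempty_homologyEquiv φ hP hn), neg_neg, Fintype.sum_sigma,
      ← Finset.sum_coe_sort]
    -- The summand depends only on the length `j` of the word, so the `t ^ j` words of that length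
    -- give a multiple.
    refine Finset.sum_congr rfl fun j _ => ?_
    have h := Finset.sum_const (s := (Finset.univ : Finset (Fin (t ^ (j : ℕ)))))
      (ReesTree.lefschetz (ReesTree.openIdealAction φ n ((j : ℕ) - 1)))
    rw [Finset.card_univ, Fintype.card_fin] at h
    exact h.symm
  · intro _
    -- Homology is indexed by numbers of vertices: index `n = m + 1` is degree `n - 1`, and index
    -- `m` is degree `n - 2`.
    obtain ⟨m, rfl⟩ := Nat.exists_eq_add_of_le' hn
    exact ReesTree.TreeProduct.nonempty_homologyEquiv φ hP hn m
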